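/- **Setting.** Let $\mathcal A$ be a semi-abelian category (pointed, Barr exact, Bourn protomodular, with binary coproducts) and $\mathcal B$ a Birkhoff subcategory of $\mathcal A$ (full, replete, reflective, closed under subobjects and regular quotients), with reflector $I\colon\mathcal A\to\mathcal B$ and unit $\eta$. Write $\mathsf{Arr}^0\mathcal A=\mathcal A$ and $\mathsf{Arr}^{n+1}\mathcal A$ for the category of arrows in $\mathsf{Arr}^{n}\mathcal A$. *Extensions.* Every object of $\mathcal A$ is a $0$-extension, and a $1$-extension is a regular epimorphism of $\mathcal A$. For $n\ge 2$ an $n$-extension is an object of $\mathsf{Arr}^n\mathcal A$, that is, a commutative square $f\circ b=a\circ f_0$ in $\mathsf{Arr}^{n-2}\mathcal A$ with $f_0\colon B_0\to A_0$, $b\colon B_0\to B$, $a\colon A_0\to A$, $f\colon B\to A$, such that $f_0$, $f$, $a$, $b$, both projections of the pullback $B\times_A A_0$ and the comparison $B_0\to B\times_A A_0$ are $(n-1)$-extensions. $\mathsf{Ext}^n\mathcal A\subseteq\mathsf{Arr}^n\mathcal A$ is the full subcategory of $n$-extensions, and $\mathcal E^n$ is the class of $(n+1)$-extensions, viewed as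 morphisms of $\mathsf{Ext}^n\mathcal A$. *Centralization.* Put $I_0=I$ and $\eta^0=\eta$ (with $I$ viewed as an endofunctor of $\mathcal A$), and let $\mu^0\colon J_0\to 1_{\mathcal A}$ be the kernel of $\eta$. For $n\ge1$ and $f\colon B\to A$ in $\mathsf{Arr}^n\mathcal A$ with kernel pair $(\pi_1,\pi_2)\colon R[f]\rightrightarrows B$, let $J_n[f]=K[J_{n-1}\pi_1]$ be the kernel of $J_{n-1}\pi_1$, mapped to $B$ by $\mu^{n-1}_B\circ J_{n-1}\pi_2\circ\ker J_{n-1}\pi_1$, let $\rho\colon B\to I_n[f]$ be the cokernel of this morphism, and let $I_nf\colon I_n[f]\to A$ be induced by $f$. Put $J_nf=(J_n[f]\to 0)$, with $\mu^n_f\colon J_nf\to f$ having the above morphism $J_n[f]\to B$ as its domain component, and $\eta^n_f=(\rho,1_A)\colon f\to I_nf$. *Trivial, central, normal.* Given a category, an endofunctor $T$ with a natural transformation $\eta\colon 1\to T$, and a class $\mathcal E$ of morphisms, a morphism $f\colon B\to A$ in $\mathcal E$ is *trivial* if its naturality square $Tf\circ\eta_B=\eta_A\circ f$ is a pullback, *central*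 if some pullback of $f$ along a morphism $A_0\to A$ in $\mathcal E$ is trivial, and *normal* if the first projection of its kernel pair is trivial. Let $\mathsf{CExt}^1_{\mathcal B}\mathcal A\subseteq\mathsf{Ext}^1\mathcal A$ be the full subcategory of regular epimorphisms of $\mathcal A$ that are central with respect to $\eta$ and the class of regular epimorphisms. For $n\ge1$ let $\mathsf{CExt}^{n+1}_{\mathcal B}\mathcal A\subseteq\mathsf{Ext}^{n+1}\mathcal A$ be the full subcategory of $(n+1)$-extensions that are normal with respect to $(I_n,\eta^n)$ and the class of $(n+1)$-extensions. Let $\mathcal Z^n$ be the class of morphisms of $\mathsf{CExt}^n_{\mathcal B}\mathcal A$ that lie in $\mathcal E^n$. *Galois structures.* A Galois structure $(\mathcal X,\mathcal Y,\mathcal E,\mathcal Z,I,H)$ is an adjunction $I\dashv H\colon\mathcal Y\to\mathcal X$ with classes $\mathcal E,\mathcal Z$ of morphisms of $\mathcal X,\mathcal Y$ such that $\mathcal X$ has pullbacks along morphisms in $\mathcal E$; $\mathcal E$ and $\mathcal Z$ contain the isomorphisms and are closed under composition and pullback-stable; $I(\mathcal E)\subseteq\mathcal Z$ and $H(\mathcal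 Z)\subseteq\mathcal E$; the counit is an isomorphism; and the unit components lie in $\mathcal E$. It is *admissible* if for each $X\in\mathcal X$ the counit of the induced adjunction between the extensions of $X$ and $\mathcal Z$-morphisms into $IX$ is an isomorphism: for every $x\colon Y\to IX$ in $\mathcal Z$, the transpose $I(X\times_{HIX}HY)\to Y$ of the projection $X\times_{HIX}HY\to HY$ is an isomorphism. It is *strongly $\mathcal E$-Birkhoff* if $\mathcal E$ consists of pullback-stable regular epimorphisms, $H$ is the inclusion of a full replete subcategory, unit components lie in $\mathcal E$, and for every $f\colon B\to A$ in $\mathcal E$ the morphism $HIf$, both projections of $A\times_{HIA}HIB$ and the comparison $(f,\eta_B)\colon B\to A\times_{HIA}HIB$ lie in $\mathcal E$. **Theorem.** For every $n\ge1$, the functor $I_n$ restricts to a functor $\mathsf{Ext}^n\mathcal A\to\mathsf{CExt}^n_{\mathcal B}\mathcal A$ which is left adjoint, with unit $\eta^n$, to the inclusion $\subseteq_n$, and $$\Gamma_n=(\mathsf{Ext}^n\mathcal A,\ \mathsf{CExt}^n_{\mathcal B}\mathcal A,\ \mathcal E^n,\ \mathcal Z^n,\ I_n,\ \subseteq_n)$$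 is a Galois structure. It is admissible and strongly $\mathcal E^n$-Birkhoff. A morphism of $\mathsf{Ext}^n\mathcal A$ is a central extension with respect to $\Gamma_n$ if and only if it is a normal extension with respect to $\Gamma_n$, and if and only if it is, as an object of $\mathsf{Arr}^{n+1}\mathcal A$, an object of $\mathsf{CExt}^{n+1}_{\mathcal B}\mathcal A$. -/

import Mathlib

open CategoryTheory CategoryTheory.Limits

universe v w u v₁ v₂ u₁ u₂

noncomputable section

namespace HigherCentral

/-! ### Semi-abelian categories and Birkhoff subcategories -/

/-- A Barr exact category: a regular category in which every internal equivalence relation is a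
kernel pair. -/
class BarrExact (A : Type u) [Category.{v} A] : Prop extends Regular A where
  isKernelPair_of_equivalenceRelation {R X : A} (p₁ p₂ : R ⟶ X) [IsEquivalenceRelation p₁ p₂] :
    ∃ (Y : A) (f : X ⟶ Y), IsKernelPair f p₁ p₂

/-- A semi-abelian category: pointed, Barr exact, Bourn protomodular, with binary coproducts.
In the pointed regular context Bourn protomodularity is the (regular) Short Five Lemma. -/
class SemiAbelian (A : Type u) [Category.{v} A] [HasZeroMorphisms A] : Prop
    extends BarrExact A where
  hasZeroObject : HasZeroObject A
  hasBinaryCoproducts : HasBinaryCoproducts A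
  short_five {B₀ A₀ B₁ A₁ : A} (f₀ : B₀ ⟶ A₀) (f : B₁ ⟶ A₁) [IsRegularEpi f₀] [IsRegularEpi f]
    (k : kernel f₀ ⟶ kernel f) (b : B₀ ⟶ B₁) (a : A₀ ⟶ A₁)
    (hk : k ≫ kernel.ι f = kernel.ι f₀ ≫ b) (hb : b ≫ f = f₀ ≫ a) [IsIso k] [IsIso a] : IsIso b

attribute [instance] SemiAbelian.hasZeroObject SemiAbelian.hasBinaryCoproducts

/-- `P` is (the class of objects of) a Birkhoff subcategory: a full replete reflective subcategory
closed under subobjects and regular quotients. (Repleteness is a special case of closure under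
subobjects.) -/
structure IsBirkhoff {A : Type u} [Category.{v} A] (P : ObjectProperty A) : Prop where
  reflective : P.ι.IsRightAdjoint
  of_mono {X Y : A} (m : X ⟶ Y) [Mono m] : P Y → P X
  of_regularEpi {X Y : A} (q : X ⟶ Y) [IsRegularEpi q] : P X → P Y

/-! ### Coequalizers in semi-abelian categories -/

section Coequalizers

variable {A : Type u} [Category.{v} A] [HasZeroMorphisms A] [SemiAbelian A]

attribute [local simp] prod.lift_fst prod.lift_snd prod.lift_fst_assoc prod.lift_snd_assoc
  coprod.inl_desc coprod.inr_desc coprod.inl_desc_assoc coprod.inr_desc_assoc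
  pullback.lift_fst pullback.lift_snd pullback.lift_fst_assoc pullback.lift_snd_assoc

lemma isRegularEpi_of_section {X Y : A} (f : X ⟶ Y) (s : Y ⟶ X) (h : s ≫ f = 𝟙 Y) :
    IsRegularEpi f := by
  have : IsSplitEpi f := ⟨⟨⟨s, h⟩⟩⟩
  infer_instance

/-- In a pullback of split epimorphisms the two canonical sections are jointly extremally epic. -/
lemma isIso_of_sections {X Y Z P T : A} {f : X ⟶ Z} {g : Y ⟶ Z} {t : Z ⟶ Y}
    {p₁ : P ⟶ X} {p₂ : P ⟶ Y} (hP : IsPullback p₁ p₂ f g) (m : T ⟶ P) [Mono m]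
    (a : X ⟶ T) (b : Y ⟶ T) (ha₁ : a ≫ m ≫ p₁ = 𝟙 X) (ha₂ : a ≫ m ≫ p₂ = f ≫ t)
    (hb₂ : b ≫ m ≫ p₂ = 𝟙 Y) : IsIso m := by
  have h₁ : IsRegularEpi (m ≫ p₂) := isRegularEpi_of_section _ b hb₂
  have h₂ : IsRegularEpi p₂ := isRegularEpi_of_section _ (b ≫ m) (by simpa using hb₂)
  have hc : kernel.ι p₂ ≫ p₁ ≫ f = 0 := by rw [hP.w, kernel.condition_assoc, zero_comp]
  have hc' : kernel.ι p₂ ≫ p₁ ≫ a ≫ m = kernel.ι p₂ := by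
    apply hP.hom_ext
    · simp [ha₁]
    · simp only [Category.assoc, ha₂, kernel.condition]
      rw [← Category.assoc p₁, ← Category.assoc (kernel.ι p₂), hc, zero_comp]
  let k : kernel (m ≫ p₂) ⟶ kernel p₂ := kernel.lift _ (kernel.ι _ ≫ m) (by simp)
  let l : kernel p₂ ⟶ kernel (m ≫ p₂) := kernel.lift _ (kernel.ι _ ≫ p₁ ≫ a) (by
    rw [Category.assoc, Category.assoc, ← Category.assoc a, ← Category.assoc p₁,
      ← Category.assoc (kernel.ι p₂), hc', kernel.condition])
  have hk : k ≫ kernel.ι p₂ = kernel.ι (m ≫ p₂) ≫ m := kernel.lift_ι _ _ _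
  have hl : l ≫ kernel.ι (m ≫ p₂) = kernel.ι p₂ ≫ p₁ ≫ a := kernel.lift_ι _ _ _
  have hlk : l ≫ k = 𝟙 _ := by
    rw [← cancel_mono (kernel.ι p₂), Category.assoc, hk, ← Category.assoc, hl]
    simpa using hc'
  have hkl : k ≫ l = 𝟙 _ := by
    have : Mono k := by
      have : Mono (k ≫ kernel.ι p₂) := by rw [hk]; infer_instance
      exact mono_of_mono k (kernel.ι p₂)
    rw [← cancel_mono k, Category.assoc, hlk]; simp
  have : IsIso k := ⟨l, hkl, hlk⟩
  exact SemiAbelian.short_five (m ≫ p₂) p₂ k m (𝟙 _) hk (by simp)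

/-- Every internal relation is difunctional (the Mal'tsev property). -/
lemma difunctional {R Y : A} (r₁ r₂ : R ⟶ Y) [Mono (prod.lift r₁ r₂)] {W : A} (x y z : W ⟶ R)
    (h₂ : x ≫ r₂ = y ≫ r₂) (h₁ : y ≫ r₁ = z ≫ r₁) :
    ∃ d : W ⟶ R, d ≫ r₁ = x ≫ r₁ ∧ d ≫ r₂ = z ≫ r₂ := by
  let f : pullback r₂ r₂ ⟶ R := pullback.snd r₂ r₂
  let g : pullback r₁ r₁ ⟶ R := pullback.fst r₁ r₁
  let s : R ⟶ pullback r₂ r₂ := pullback.lift (𝟙 _) (𝟙 _) rfl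
  let t : R ⟶ pullback r₁ r₁ := pullback.lift (𝟙 _) (𝟙 _) rfl
  let φ : pullback f g ⟶ Y ⨯ Y := prod.lift (pullback.fst f g ≫ pullback.fst r₂ r₂ ≫ r₁)
    (pullback.snd f g ≫ pullback.snd r₁ r₁ ≫ r₂)
  let m := pullback.fst φ (prod.lift r₁ r₂)
  let i : pullback r₂ r₂ ⟶ pullback f g := pullback.lift (𝟙 _) (f ≫ t) (by simp [t, g])
  let j : pullback r₁ r₁ ⟶ pullback f g := pullback.lift (g ≫ s) (𝟙 _) (by simp [s, f])
  let a : pullback r₂ r₂ ⟶ pullback φ (prod.lift r₁ r₂) :=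
    pullback.lift i (pullback.fst r₂ r₂) (by
      ext
      · simp [φ, i]
      · simp [φ, i, t, f, pullback.condition])
  let b : pullback r₁ r₁ ⟶ pullback φ (prod.lift r₁ r₂) :=
    pullback.lift j (pullback.snd r₁ r₁) (by
      ext
      · simp [φ, j, s, g, pullback.condition]
      · simp [φ, j])
  have : IsIso m := isIso_of_sections (t := t) (IsPullback.of_hasPullback f g) m a b
    (by simp [a, m, i]) (by simp [a, m, i]) (by simp [b, m, j])
  let e : W ⟶ pullback f g := pullback.lift (pullback.lift x y h₂) (pullback.lift y z h₁)
    (by simp [f, g])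
  refine ⟨e ≫ inv m ≫ pullback.snd φ (prod.lift r₁ r₂), ?_⟩
  have key : (e ≫ inv m ≫ pullback.snd φ (prod.lift r₁ r₂)) ≫ prod.lift r₁ r₂ = e ≫ φ := by
    have : m ≫ φ = pullback.snd φ (prod.lift r₁ r₂) ≫ prod.lift r₁ r₂ := pullback.condition
    rw [Category.assoc, Category.assoc, ← this, IsIso.inv_hom_id_assoc]
  constructor
  · have := congrArg (· ≫ prod.fst) key
    simpa [φ, e] using this
  · have := congrArg (· ≫ prod.snd) key
    simpa [φ, e] using this

/-- Reflexive relations are equivalence relations. -/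
lemma isEquivalenceRelation_of_reflexive {R Y : A} (r₁ r₂ : R ⟶ Y) [Mono (prod.lift r₁ r₂)]
    (s : Y ⟶ R) (h₁ : s ≫ r₁ = 𝟙 Y) (h₂ : s ≫ r₂ = 𝟙 Y) : IsEquivalenceRelation r₁ r₂ := by
  obtain ⟨σ, hσ₁, hσ₂⟩ := difunctional r₁ r₂ (r₂ ≫ s) (𝟙 R) (r₁ ≫ s) (by simp [h₂]) (by simp [h₁])
  obtain ⟨τ, hτ₁, hτ₂⟩ := difunctional r₁ r₂ (pullback.fst r₂ r₁)
    (pullback.fst r₂ r₁ ≫ r₂ ≫ s) (pullback.snd r₂ r₁) (by simp [h₂])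
    (by simp [h₁, pullback.condition])
  refine ⟨⟨{ right_cancellation := ?_, r := s, reflexivity₁ := h₁, reflexivity₂ := h₂,
             s := σ, symmetry₁ := ?_, symmetry₂ := ?_, c := _,
             isLimit := pullbackIsPullback r₂ r₁, t := τ,
             transitivity₁ := hτ₁, transitivity₂ := hτ₂ }⟩⟩
  · intro W f g hf hg
    rw [← cancel_mono (prod.lift r₁ r₂)]
    ext <;> simp [hf, hg]
  · simp [hσ₁, h₁]
  · simp [hσ₂, h₂]

instance hasCoequalizers_of_semiAbelian : HasCoequalizers A := by
  have main : ∀ {X Y : A} (f g : X ⟶ Y), HasColimit (parallelPair f g) := by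
    intro X Y f g
    let h : X ⨿ Y ⟶ Y ⨯ Y := prod.lift (coprod.desc f (𝟙 Y)) (coprod.desc g (𝟙 Y))
    let F := Regular.strongEpiMonoFactorisation h
    have hF : F.e ≫ F.m = h := F.fac
    have : Mono F.m := F.m_mono
    have : Epi F.e := inferInstance
    let r₁ : F.I ⟶ Y := F.m ≫ prod.fst
    let r₂ : F.I ⟶ Y := F.m ≫ prod.snd
    have e₁ : F.e ≫ r₁ = coprod.desc f (𝟙 Y) := by
      simp only [r₁]; rw [← Category.assoc, hF]; simp [h]
    have e₂ : F.e ≫ r₂ = coprod.desc g (𝟙 Y) := by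
      simp only [r₂]; rw [← Category.assoc, hF]; simp [h]
    have hm : prod.lift r₁ r₂ = F.m := by ext <;> simp [r₁, r₂]
    have : Mono (prod.lift r₁ r₂) := by rw [hm]; infer_instance
    have : IsEquivalenceRelation r₁ r₂ := isEquivalenceRelation_of_reflexive r₁ r₂
      (coprod.inr ≫ F.e) (by simp [e₁]) (by simp [e₂])
    obtain ⟨Z, q, hq⟩ := BarrExact.isKernelPair_of_equivalenceRelation r₁ r₂
    have : HasCoequalizer r₁ r₂ := Regular.hasCoequalizer_of_isKernelPair hq
    have hc : f ≫ coequalizer.π r₁ r₂ = g ≫ coequalizer.π r₁ r₂ := by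
      have := congrArg (fun k => coprod.inl ≫ F.e ≫ k) (coequalizer.condition r₁ r₂)
      simp only [← Category.assoc] at this
      simpa only [Category.assoc _ F.e, e₁, e₂, coprod.inl_desc] using this
    have hd : ∀ {T : A} (k : Y ⟶ T), f ≫ k = g ≫ k → r₁ ≫ k = r₂ ≫ k := by
      intro T k hk
      rw [← cancel_epi F.e, ← Category.assoc F.e r₁, ← Category.assoc F.e r₂, e₁, e₂]
      ext <;> simp [hk]
    exact ⟨⟨⟨Cofork.ofπ (coequalizer.π r₁ r₂) hc, Cofork.IsColimit.mk _
      (fun c => coequalizer.desc c.π (hd _ c.condition))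
      (fun c => by simp) (fun c k hk => by
        refine coequalizer.hom_ext (f := r₁) (g := r₂) (k := k) ?_
        rw [coequalizer.π_desc]
        exact hk)⟩⟩⟩
  exact hasCoequalizers_of_hasColimit_parallelPair A

end Coequalizers

/-! ### Galois structures -/

section Galois

variable {𝒜 : Type u₁} [Category.{v₁} 𝒜] {ℬ : Type u₂} [Category.{v₂} ℬ]

/-- The sextuple `(𝒜, ℬ, E, Z, I, H)`, with `adj : I ⊣ H`, is a Galois structure. -/
structure IsGaloisStructure (E : MorphismProperty 𝒜) (Z : MorphismProperty ℬ)
    {I : 𝒜 ⥤ ℬ} {H : ℬ ⥤ 𝒜} (adj : I ⊣ H) : Prop where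
  hasPullback {X Y W : 𝒜} (f : X ⟶ Y) (g : W ⟶ Y) : E f → HasPullback f g
  isomorphisms_le_left : MorphismProperty.isomorphisms 𝒜 ≤ E
  comp_left : E.IsStableUnderComposition
  baseChange_left : E.IsStableUnderBaseChange
  isomorphisms_le_right : MorphismProperty.isomorphisms ℬ ≤ Z
  comp_right : Z.IsStableUnderComposition
  baseChange_right : Z.IsStableUnderBaseChange
  map_reflector {X Y : 𝒜} (f : X ⟶ Y) : E f → Z (I.map f)
  map_inclusion {X Y : ℬ} (f : X ⟶ Y) : Z f → E (H.map f)
  isIso_counit : IsIso adj.counit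
  unit_mem (X : 𝒜) : E (adj.unit.app X)

/-- Admissibility. For an object `X` of `𝒜` and `x : Y ⟶ I X` in `Z`, the extension `H^X x` is the
pullback `p : P ⟶ X` of `H x` along the unit of `X`, and the component at `x` of the counit of the
induced adjunction `I^X ⊣ H^X` is the morphism `I P ⟶ Y` which is the transpose of the other
projection `q : P ⟶ H Y`. It has to be an isomorphism. -/
def IsAdmissible (Z : MorphismProperty ℬ) {I : 𝒜 ⥤ ℬ} {H : ℬ ⥤ 𝒜} (adj : I ⊣ H) : Prop :=
  ∀ ⦃X : 𝒜⦄ ⦃Y : ℬ⦄ (x : Y ⟶ I.obj X), Z x →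
    ∀ ⦃P : 𝒜⦄ (p : P ⟶ X) (q : P ⟶ H.obj Y), IsPullback p q (adj.unit.app X) (H.map x) →
      IsIso ((adj.homEquiv P Y).symm q)

/-- `E` is a class of pullback-stable regular epimorphisms of `𝒜`, and `H` is the inclusion of a
full replete `E`-reflective subcategory, with reflector `I`, which is strongly `E`-Birkhoff. -/
structure IsStronglyBirkhoff (E : MorphismProperty 𝒜) {I : 𝒜 ⥤ ℬ} {H : ℬ ⥤ 𝒜} (adj : I ⊣ H) :
    Prop where
  le_regularEpi : E ≤ MorphismProperty.regularEpi 𝒜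
  baseChange : E.IsStableUnderBaseChange
  full : H.Full
  faithful : H.Faithful
  replete (Y : ℬ) (X : 𝒜) (e : H.obj Y ≅ X) : ∃ Y' : ℬ, H.obj Y' = X
  unit_mem (X : 𝒜) : E (adj.unit.app X)
  map_mem {X Y : 𝒜} (f : X ⟶ Y) : E f → E (H.map (I.map f))
  comparison_mem {X Y : 𝒜} (f : X ⟶ Y) : E f →
    ∃ (P : 𝒜) (p : P ⟶ Y) (q : P ⟶ H.obj (I.obj X))
      (h : IsPullback p q (adj.unit.app Y) (H.map (I.map f))),
      E p ∧ E q ∧ E (h.lift f (adj.unit.app X) (adj.unit.naturality f))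

/-! Trivial, central and normal extensions, for a class `E` of morphisms and the unit
`η : 𝟭 ⟶ T` of a reflection (seen as an endofunctor `T`). -/

/-- `f` belongs to `E` and its naturality square for `η` is a pullback. -/
def IsTrivialExtension (E : MorphismProperty 𝒜) {T : 𝒜 ⥤ 𝒜} (η : 𝟭 𝒜 ⟶ T) {X Y : 𝒜}
    (f : X ⟶ Y) : Prop :=
  E f ∧ IsPullback (η.app X) f (T.map f) (η.app Y)

/-- `f` belongs to `E` and some pullback of `f` along a morphism `a` in `E` is trivial. -/
def IsCentralExtension (E : MorphismProperty 𝒜) {T : 𝒜 ⥤ 𝒜} (η : 𝟭 𝒜 ⟶ T) {X Y : 𝒜}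
    (f : X ⟶ Y) : Prop :=
  E f ∧ ∃ (X₀ Y₀ : 𝒜) (a : Y₀ ⟶ Y) (a' : X₀ ⟶ X) (f₀ : X₀ ⟶ Y₀),
    E a ∧ IsPullback a' f₀ f a ∧ IsTrivialExtension E η f₀

/-- `f` belongs to `E` and the first projection of its kernel pair is trivial. -/
def IsNormalExtension (E : MorphismProperty 𝒜) {T : 𝒜 ⥤ 𝒜} (η : 𝟭 𝒜 ⟶ T) {X Y : 𝒜}
    (f : X ⟶ Y) : Prop :=
  E f ∧ ∃ (R : 𝒜) (π₁ π₂ : R ⟶ X), IsKernelPair f π₁ π₂ ∧ IsTrivialExtension E η π₁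

end Galois

/-! ### Arrow categories, higher extensions and centralization -/

section Arrow

variable {C : Type w} [Category.{v} C]

/-- If `E` is the class of `(n+1)`-extensions, seen as morphisms between `n`-extensions, then
`squareExtension E` is the class of `(n+2)`-extensions, seen as morphisms (commutative squares)
between `(n+1)`-extensions: all the arrows of the square, the two projections of the pullback of
its right and bottom sides, and the comparison to that pullback, are in `E`. -/
def squareExtension (E : MorphismProperty C) : MorphismProperty (Arrow C) := fun b a φ =>
  E φ.left ∧ E φ.right ∧ E b.hom ∧ E a.hom ∧
    ∃ (P : C) (p : P ⟶ a.left) (q : P ⟶ b.right) (h : IsPullback p q a.hom φ.right),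
      E p ∧ E q ∧ E (h.lift φ.left b.hom φ.w)

instance arrowHasZeroMorphisms [HasZeroMorphisms C] : HasZeroMorphisms (Arrow C) where
  zero f g := ⟨Arrow.homMk 0 0 (by simp)⟩
  comp_zero _ _ := by ext <;> exact comp_zero
  zero_comp _ _ _ _ := by ext <;> exact zero_comp

open ZeroObject in
instance arrowHasZeroObject [HasZeroMorphisms C] [HasZeroObject C] : HasZeroObject (Arrow C) where
  zero := ⟨Arrow.mk (𝟙 (0 : C)),
    { unique_to := fun f => ⟨⟨⟨Arrow.homMk 0 0 (by simp)⟩, fun φ => by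
        ext <;> exact (isZero_zero C).eq_of_src _ _⟩⟩
      unique_from := fun f => ⟨⟨⟨Arrow.homMk 0 0 (by simp)⟩, fun φ => by
        ext <;> exact (isZero_zero C).eq_of_tgt _ _⟩⟩ }⟩

instance arrowHasCoequalizers [HasCoequalizers C] : HasCoequalizers (Arrow C) :=
  inferInstanceAs (HasColimitsOfShape WalkingParallelPair (Arrow C))

/-- Endofunctors `J`, `I` with transformations `μ : J ⟶ 𝟭` and `η : 𝟭 ⟶ I`. -/
structure Centralization (C : Type w) [Category.{v} C] where
  J : C ⥤ C
  I : C ⥤ C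
  μ : J ⟶ 𝟭 C
  η : 𝟭 C ⟶ I

variable [HasZeroMorphisms C] [HasFiniteLimits C]

/-- The case `n = 0`: `I` and `η` are given by a reflection, and `J` is the kernel of `η`. -/
def Centralization.ofUnit {T : C ⥤ C} (η : 𝟭 C ⟶ T) : Centralization C where
  J :=
    { obj := fun X => kernel (η.app X)
      map := fun {X Y} f => kernel.map (η.app X) (η.app Y) f (T.map f) (η.naturality f).symm
      map_id := fun X => by
        rw [← cancel_mono (kernel.ι (η.app X))]; simp [kernel.map]
      map_comp := fun {X Y Z} f g => by
        rw [← cancel_mono (kernel.ι (η.app Z))]; simp [kernel.map] }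
  I := T
  μ :=
    { app := fun X => kernel.ι (η.app X)
      naturality := fun X Y f => by simp [kernel.map] }
  η := η

namespace Centralization

variable (D : Centralization C)

/-- The morphism `R[f] ⟶ R[g]` of kernel pairs induced by `φ : f ⟶ g`. -/
def kernelPairMap {f g : Arrow C} (φ : f ⟶ g) : pullback f.hom f.hom ⟶ pullback g.hom g.hom :=
  pullback.map f.hom f.hom g.hom g.hom φ.left φ.left φ.right φ.w.symm φ.w.symm

/-- The object `J₁[f] = K[J π₁]`, where `(π₁, π₂)` is the kernel pair of `f`. -/
abbrev top (f : Arrow C) : C := kernel (D.J.map (pullback.fst f.hom f.hom))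

/-- The composite of `ker (J π₁)`, `J π₂` and `μ`, from `J₁[f]` to the domain of `f`. -/
def topι (f : Arrow C) : D.top f ⟶ f.left :=
  kernel.ι (D.J.map (pullback.fst f.hom f.hom)) ≫ D.J.map (pullback.snd f.hom f.hom) ≫
    D.μ.app f.left

lemma topι_hom (f : Arrow C) : D.topι f ≫ f.hom = 0 := by
  have h₁ := D.μ.naturality (pullback.fst f.hom f.hom)
  have h₂ := D.μ.naturality (pullback.snd f.hom f.hom)
  simp only [Functor.id_map] at h₁ h₂
  have h : D.J.map (pullback.snd f.hom f.hom) ≫ D.μ.app f.left ≫ f.hom =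
      D.J.map (pullback.fst f.hom f.hom) ≫ D.μ.app f.left ≫ f.hom := by
    rw [← Category.assoc, ← Category.assoc, h₁, h₂, Category.assoc, Category.assoc,
      pullback.condition]
  simp only [topι, Category.assoc]
  rw [h, kernel.condition_assoc, zero_comp]

/-- The morphism `J₁[f] ⟶ J₁[g]` induced by `φ : f ⟶ g`. -/
def topMap {f g : Arrow C} (φ : f ⟶ g) : D.top f ⟶ D.top g :=
  kernel.map (D.J.map (pullback.fst f.hom f.hom)) (D.J.map (pullback.fst g.hom g.hom))
    (D.J.map (kernelPairMap φ)) (D.J.map φ.left) (by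
      rw [← D.J.map_comp, ← D.J.map_comp, kernelPairMap, pullback.map, pullback.lift_fst])

lemma topMap_ι {f g : Arrow C} (φ : f ⟶ g) :
    D.topMap φ ≫ kernel.ι (D.J.map (pullback.fst g.hom g.hom)) =
      kernel.ι (D.J.map (pullback.fst f.hom f.hom)) ≫ D.J.map (kernelPairMap φ) :=
  kernel.lift_ι _ _ _

lemma topMap_topι {f g : Arrow C} (φ : f ⟶ g) :
    D.topMap φ ≫ D.topι g = D.topι f ≫ φ.left := by
  have h := D.μ.naturality φ.left
  simp only [Functor.id_map] at h
  have h' : D.J.map (kernelPairMap φ) ≫ D.J.map (pullback.snd g.hom g.hom) =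
      D.J.map (pullback.snd f.hom f.hom) ≫ D.J.map φ.left := by
    rw [← D.J.map_comp, ← D.J.map_comp, kernelPairMap, pullback.map, pullback.lift_snd]
  simp only [topι, Category.assoc]
  rw [← Category.assoc, topMap_ι, Category.assoc, ← Category.assoc (D.J.map (kernelPairMap φ)),
    h', Category.assoc, h]

lemma topMap_id (f : Arrow C) : D.topMap (𝟙 f) = 𝟙 (D.top f) := by
  have h : kernelPairMap (𝟙 f) = 𝟙 _ := by
    apply pullback.hom_ext
    · rw [kernelPairMap, pullback.map, pullback.lift_fst]; simp
    · rw [kernelPairMap, pullback.map, pullback.lift_snd]; simp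
  rw [← cancel_mono (kernel.ι (D.J.map (pullback.fst f.hom f.hom))), topMap_ι, h, D.J.map_id]
  exact (Category.comp_id _).trans (Category.id_comp _).symm

lemma topMap_comp {f g h : Arrow C} (φ : f ⟶ g) (ψ : g ⟶ h) :
    D.topMap (φ ≫ ψ) = D.topMap φ ≫ D.topMap ψ := by
  have e : kernelPairMap (φ ≫ ψ) = kernelPairMap φ ≫ kernelPairMap ψ := by
    apply pullback.hom_ext
    · simp only [kernelPairMap, pullback.map, pullback.lift_fst, Category.assoc,
        pullback.lift_fst_assoc, Arrow.comp_left]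
    · simp only [kernelPairMap, pullback.map, pullback.lift_snd, Category.assoc,
        pullback.lift_snd_assoc, Arrow.comp_left]
  rw [← cancel_mono (kernel.ι (D.J.map (pullback.fst h.hom h.hom))), topMap_ι, e, D.J.map_comp,
    Category.assoc, topMap_ι, ← Category.assoc (D.topMap φ), topMap_ι, Category.assoc]

variable [HasZeroObject C] [HasCoequalizers C]

open ZeroObject in
/-- The passage from `n` to `n + 1`. For `f : B ⟶ A`, the arrow `J₁ f` is `J₁[f] ⟶ 0`, the
transformation `μ¹` has top component `J₁[f] ⟶ B`, and `η¹` is the cokernel of `μ¹`, namely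
`(ρ, 𝟙 A)` with `ρ : B ⟶ B / J₁[f]`; so `I₁ f` is the induced morphism `B / J₁[f] ⟶ A`. -/
def next : Centralization (Arrow C) where
  J :=
    { obj := fun f => Arrow.mk (0 : D.top f ⟶ (0 : C))
      map := fun {f g} φ => Arrow.homMk (D.topMap φ) (𝟙 (0 : C)) (by simp)
      map_id := fun f => by
        ext
        · exact D.topMap_id f
        · rfl
      map_comp := fun {f g h} φ ψ => by
        ext
        · exact D.topMap_comp φ ψ
        · exact (Category.comp_id (𝟙 (0 : C))).symm }
  I :=
    { obj := fun f => Arrow.mk (cokernel.desc (D.topι f) f.hom (D.topι_hom f))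
      map := fun {f g} φ => Arrow.homMk
        (cokernel.map (D.topι f) (D.topι g) (D.topMap φ) φ.left (D.topMap_topι φ).symm) φ.right (by
          rw [← cancel_epi (cokernel.π (D.topι f))]
          simp [cokernel.map])
      map_id := fun f => by
        ext
        · dsimp
          rw [← cancel_epi (cokernel.π (D.topι f))]
          simp [cokernel.map]
        · rfl
      map_comp := fun {f g h} φ ψ => by
        ext
        · dsimp
          rw [← cancel_epi (cokernel.π (D.topι f))]
          simp [cokernel.map]
        · rfl }
  μ :=
    { app := fun f => Arrow.homMk (D.topι f) 0 (by simp [topι_hom])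
      naturality := fun f g φ => by
        ext
        · exact D.topMap_topι φ
        · exact (isZero_zero C).eq_of_src _ _ }
  η :=
    { app := fun f => Arrow.homMk (cokernel.π (D.topι f)) (𝟙 f.right) (by simp)
      naturality := fun f g φ => by
        ext
        · simp [cokernel.map]
        · simp }

end Centralization

end Arrow

/-! ### The tower of (central) extensions -/

/-- The data of dimension `n`: the category `C` of `n`-fold arrows, the class `E` of
`(n+1)`-extensions as morphisms between `n`-extensions, the classes `ext` of `n`-extensions and
`cext` of central `n`-extensions, and the functors `J`, `I` with `μ`, `η`. -/
structure Level where
  C : Type w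
  [cat : Category.{v} C]
  [zeroMorphisms : HasZeroMorphisms C]
  [zeroObject : HasZeroObject C]
  [finiteLimits : HasFiniteLimits C]
  [coequalizers : HasCoequalizers C]
  E : MorphismProperty C
  ext : ObjectProperty C
  cext : ObjectProperty C
  cen : Centralization C

attribute [instance] Level.cat Level.zeroMorphisms Level.zeroObject Level.finiteLimits
  Level.coequalizers

namespace Level

/-- One dimension up, where `K` is the class of central `(n+1)`-extensions. -/
def next (S : Level.{v, w}) (K : ObjectProperty (Arrow S.C)) : Level.{v, max w v} where
  C := Arrow S.C
  E := squareExtension S.E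
  ext f := S.E f.hom
  cext := K
  cen := S.cen.next

/-- The category of `n`-extensions. -/
abbrev Ext (S : Level.{v, w}) : Type w := S.ext.FullSubcategory

/-- The central `n`-extensions, as a class of objects of the category of `n`-extensions. -/
abbrev central (S : Level.{v, w}) : ObjectProperty S.Ext := S.cext.inverseImage S.ext.ι

/-- The category of central `n`-extensions. -/
abbrev CExt (S : Level.{v, w}) : Type w := S.central.FullSubcategory

/-- The `(n+1)`-extensions, as a class of morphisms of the category of `n`-extensions. -/
abbrev extE (S : Level.{v, w}) : MorphismProperty S.Ext := S.E.inverseImage S.ext.ι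

/-- The `(n+1)`-extensions between central `n`-extensions. -/
abbrev cextZ (S : Level.{v, w}) : MorphismProperty S.CExt := S.extE.inverseImage S.central.ι

/-- The (co)restriction of `I` to a functor from `n`-extensions to central `n`-extensions. -/
def reflector (S : Level.{v, w}) (h₁ : ∀ X : S.Ext, S.ext (S.cen.I.obj X.obj))
    (h₂ : ∀ X : S.Ext, S.cext (S.cen.I.obj X.obj)) : S.Ext ⥤ S.CExt :=
  S.central.lift (S.ext.lift (S.ext.ι ⋙ S.cen.I) h₁) h₂

end Level

section Tower

variable {A : Type u} [Category.{v} A] [HasZeroMorphisms A] [SemiAbelian A]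
  {B : ObjectProperty A} {I : A ⥤ B.FullSubcategory} (adj : I ⊣ B.ι)

/-- Dimension `0`: every object of `A` is a `0`-extension, the `1`-extensions are the regular
epimorphisms, and `B` is the class of central `0`-extensions. -/
def levelZero : Level.{v, u} where
  C := A
  E := MorphismProperty.regularEpi A
  ext := ⊤
  cext := B
  cen := Centralization.ofUnit adj.unit

/-- `levelSucc adj n` is dimension `n + 1`. The central `1`-extensions are the extensions of `A`
that are central with respect to `B`; for `n ≥ 1`, the central `(n+1)`-extensions are the
`(n+1)`-extensions that are normal with respect to the structure in dimension `n`. -/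
def levelSucc : ℕ → Level.{v, max u v}
  | 0 => (levelZero adj).next fun f =>
      IsCentralExtension (levelZero adj).E (levelZero adj).cen.η f.hom
  | n + 1 => (levelSucc n).next fun f =>
      IsNormalExtension (levelSucc n).E (levelSucc n).cen.η f.hom

end Tower

end HigherCentral

end

open HigherCentral

/-!
The proof is an induction on the dimension. The invariant, `Level.IsBirkhoff`, describes one level
of the tower inside a semi-abelian category `C`, the category of `n`-fold arrows, which is again
semi-abelian (`arrowSemiAbelian`). Let `P` be the class of `n`-extensions.

*Extensions.* An `(n+1)`-extension is the same as a regular epimorphism of `C` whose domain and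
kernel lie in `P` (`extensionClass`); this is compatible with the definition by squares and
comparison morphisms (`extensionClass_arrowClass`). Everything needed about extensions (composition,
cancellation, base change) then follows from four closure properties of `P`, collected in
`IsExtensionClosed`: zero objects, extensions, quotients by a kernel in `P`, and kernels of split
epimorphisms. They pass to the next dimension by comparing the kernels of the rows and columns of a
square (`IsExtensionClosed.arrowClass`).

*Centralization.* On `P`, the transformation `μ : J ⟶ 𝟭` is the kernel of the regular epimorphism
`η : 𝟭 ⟶ I`, the functor `J` preserves `n`-extensions and `(n+1)`-extensions, and `I` is idempotent
(`IsBirkhoffCentralization`). In dimension zero this holds for a Birkhoff subcategory. Two facts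
carry it one dimension up. First, for a morphism `φ : f ⟶ g` which is a double extension, `J` turns
the first projections of the kernel pairs of `f` and `g` into a split epimorphism between
extensions, so the induced morphism `J₁[f] ⟶ J₁[g]` between their kernels is an extension
(`topMap_mem`). Secondly, `J₁[f]` is a normal subobject of the kernel pair `R[f]`, and in a
semi-abelian category regular images of normal monomorphisms are normal
(`isRegularEpi_to_kernel_cokernel`), so that `J₁[f] ⟶ B` is the kernel of its cokernel
(`isKernelOf_topι`). Idempotence follows, since `J₁[f] ⟶ J₁[I₁ f]` is both a regular epimorphism and
zero.

*Consequences.* An extension `f` is trivial when `J f` is invertible, and normal when `J₁[f] = 0`. A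
trivial extension has `J₁[f] = 0`, and this property descends along pullbacks since `J₁` preserves
extensions, so central and normal extensions agree, and they are the extensions fixed by the
reflection one dimension up. Admissibility holds because `J` of a pullback of an extension is a
regular epimorphism (`isIso_of_isPullback_unit`), and the strong Birkhoff condition because the
naturality square of `η` at `f` is a quotient of `f` with kernel the extension `J f`
(`naturality_mem`).
-/

noncomputable section

namespace HigherCentral

/-! ### Regular epimorphisms in a regular category -/

section RegularEpis

variable {C : Type u} [Category.{v} C] [Regular C]

lemma isRegularEpi_iff_strongEpi {X Y : C} (f : X ⟶ Y) : IsRegularEpi f ↔ StrongEpi f := by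
  constructor
  · intro h
    infer_instance
  · intro h
    infer_instance

lemma isRegularEpi_comp {X Y Z : C} {f : X ⟶ Y} {g : Y ⟶ Z} (hf : IsRegularEpi f)
    (hg : IsRegularEpi g) : IsRegularEpi (f ≫ g) := by
  rw [isRegularEpi_iff_strongEpi] at *
  infer_instance

lemma isRegularEpi_of_comp {X Y Z : C} {f : X ⟶ Y} {g : Y ⟶ Z} (h : IsRegularEpi (f ≫ g)) :
    IsRegularEpi g := by
  rw [isRegularEpi_iff_strongEpi] at *
  exact strongEpi_of_strongEpi f g

lemma isRegularEpi_of_isPullback {P X Y W : C} {p : P ⟶ X} {q : P ⟶ W} {f : X ⟶ Y} {g : W ⟶ Y}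
    (h : IsPullback p q f g) (hf : IsRegularEpi f) : IsRegularEpi q :=
  Regular.regularEpiIsStableUnderBaseChange.of_isPullback h hf

lemma isIso_of_isRegularEpi_of_mono {X Y : C} {f : X ⟶ Y} (hf : IsRegularEpi f) (hm : Mono f) :
    IsIso f := by
  rw [isRegularEpi_iff_strongEpi] at hf
  exact isIso_of_mono_of_strongEpi f

/-- Factorization of a morphism through its image. -/
lemma exists_image {X Y : C} (f : X ⟶ Y) :
    ∃ (M : C) (e : X ⟶ M) (m : M ⟶ Y), IsRegularEpi e ∧ Mono m ∧ e ≫ m = f :=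
  ⟨_, (Regular.strongEpiMonoFactorisation f).e, (Regular.strongEpiMonoFactorisation f).m,
    inferInstance, (Regular.strongEpiMonoFactorisation f).m_mono,
    (Regular.strongEpiMonoFactorisation f).fac⟩

end RegularEpis

/-! ### Kernels -/

section Kernels

variable {C : Type u} [Category.{v} C] [HasZeroMorphisms C]

/-- `k` is a kernel of `f`. (A propositional form of `IsLimit (KernelFork.ofι k _)`, convenient to
move a kernel along pullbacks and between a category and its category of arrows.) -/
structure IsKernelOf {K X Y : C} (k : K ⟶ X) (f : X ⟶ Y) : Prop where
  mono : Mono k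
  w : k ≫ f = 0
  exists_lift {T : C} (t : T ⟶ X) : t ≫ f = 0 → ∃ l : T ⟶ K, l ≫ k = t

lemma isKernelOf_kernel_ι {X Y : C} (f : X ⟶ Y) [HasKernel f] : IsKernelOf (kernel.ι f) f :=
  ⟨inferInstance, kernel.condition f, fun t ht => ⟨kernel.lift f t ht, kernel.lift_ι f t ht⟩⟩

namespace IsKernelOf

lemma exists_iso {K K' X Y : C} {k : K ⟶ X} {k' : K' ⟶ X} {f : X ⟶ Y} (h : IsKernelOf k f)
    (h' : IsKernelOf k' f) : ∃ e : K ≅ K', e.hom ≫ k' = k := by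
  obtain ⟨a, ha⟩ := h'.exists_lift k h.w
  obtain ⟨b, hb⟩ := h.exists_lift k' h'.w
  have := h.mono
  have := h'.mono
  exact ⟨⟨a, b, by rw [← cancel_mono k, Category.assoc, hb, ha, Category.id_comp],
    by rw [← cancel_mono k', Category.assoc, ha, hb, Category.id_comp]⟩, ha⟩

lemma iso_comp {K K' X Y : C} {k : K ⟶ X} {f : X ⟶ Y} (h : IsKernelOf k f) (e : K' ⟶ K)
    [IsIso e] : IsKernelOf (e ≫ k) f := by
  have := h.mono
  refine ⟨inferInstance, by rw [Category.assoc, h.w, comp_zero], fun t ht => ?_⟩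
  obtain ⟨l, hl⟩ := h.exists_lift t ht
  exact ⟨l ≫ inv e, by simp [hl]⟩

/-- A pullback of `f` has the same kernel object as `f`. -/
lemma of_isPullback {K P X Y W : C} {p : P ⟶ X} {q : P ⟶ W} {f : X ⟶ Y} {g : W ⟶ Y}
    (h : IsPullback p q f g) {k : K ⟶ X} (hk : IsKernelOf k f) {k' : K ⟶ P} (h₁ : k' ≫ p = k)
    (h₂ : k' ≫ q = 0) : IsKernelOf k' q := by
  have := hk.mono
  have : Mono (k' ≫ p) := by rwa [h₁]
  refine ⟨mono_of_mono k' p, h₂, fun t ht => ?_⟩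
  obtain ⟨l, hl⟩ := hk.exists_lift (t ≫ p) (by
    rw [Category.assoc, h.w, ← Category.assoc, ht, zero_comp])
  refine ⟨l, h.hom_ext ?_ ?_⟩
  · rw [Category.assoc, h₁, hl]
  · rw [Category.assoc, h₂, ht, comp_zero]

lemma exists_of_isPullback {K P X Y W : C} {p : P ⟶ X} {q : P ⟶ W} {f : X ⟶ Y} {g : W ⟶ Y}
    (h : IsPullback p q f g) {k : K ⟶ X} (hk : IsKernelOf k f) :
    ∃ k' : K ⟶ P, k' ≫ p = k ∧ k' ≫ q = 0 ∧ IsKernelOf k' q :=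
  ⟨h.lift k 0 (by rw [hk.w, zero_comp]), h.lift_fst _ _ _, h.lift_snd _ _ _,
    of_isPullback h hk (h.lift_fst _ _ _) (h.lift_snd _ _ _)⟩

lemma map_isPullback {K P X Y W : C} {p : P ⟶ X} {q : P ⟶ W} {f : X ⟶ Y} {g : W ⟶ Y}
    (h : IsPullback p q f g) {k' : K ⟶ P} (hk : IsKernelOf k' q) : IsKernelOf (k' ≫ p) f := by
  have := hk.mono
  refine ⟨⟨fun a b hab => ?_⟩, by
    rw [Category.assoc, h.w, ← Category.assoc, hk.w, zero_comp], fun t ht => ?_⟩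
  · rw [← cancel_mono k']
    apply h.hom_ext
    · simpa using hab
    · rw [Category.assoc, Category.assoc, hk.w, comp_zero, comp_zero]
  · obtain ⟨l, hl⟩ := hk.exists_lift (h.lift t 0 (by rw [ht, zero_comp])) (h.lift_snd _ _ _)
    exact ⟨l, by rw [← Category.assoc, hl, h.lift_fst]⟩

/-- For morphisms `c ≫ p = f`, the morphism induced between the kernels of `f` and `p` is a
pullback of `c`. -/
lemma isPullback_map {K L X P Y : C} {c : X ⟶ P} {p : P ⟶ Y} {f : X ⟶ Y} (hc : c ≫ p = f)
    {k : K ⟶ X} {l : L ⟶ P} (hk : IsKernelOf k f) (hl : IsKernelOf l p) {u : K ⟶ L}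
    (hu : u ≫ l = k ≫ c) : IsPullback k u c l := by
  have := hk.mono
  have := hl.mono
  have hs (s : PullbackCone c l) : ∃ t : s.pt ⟶ K, t ≫ k = s.fst := hk.exists_lift s.fst (by
    rw [← hc, ← Category.assoc, s.condition, Category.assoc, hl.w, comp_zero])
  refine ⟨⟨hu.symm⟩, ⟨PullbackCone.IsLimit.mk _ (fun s => (hs s).choose)
    (fun s => (hs s).choose_spec) (fun s => ?_) (fun s m hm _ => ?_)⟩⟩
  · rw [← cancel_mono l, Category.assoc, hu, ← Category.assoc, (hs s).choose_spec, s.condition]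
  · rw [← cancel_mono k, hm, (hs s).choose_spec]

end IsKernelOf

lemma isZero_of_epi_zero {K L : C} (f : K ⟶ L) [Epi f] (hf : f = 0) : IsZero L :=
  IsZero.of_epi_eq_zero f hf

lemma isKernelOf_zero_of_mono [HasZeroObject C] {Z X Y : C} (hZ : IsZero Z) (f : X ⟶ Y) [Mono f] :
    IsKernelOf (0 : Z ⟶ X) f :=
  ⟨⟨fun _ _ _ => hZ.eq_of_tgt _ _⟩, zero_comp, fun t ht => ⟨0, by
    rw [← cancel_mono f, ht]; simp⟩⟩

end Kernels

/-! ### Exactness properties of semi-abelian categories -/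

section SemiAbelian

variable {C : Type u} [Category.{v} C] [HasZeroMorphisms C] [SemiAbelian C]

/-- The Short Five Lemma, for arbitrary choices of the kernels. -/
lemma isIso_of_isKernelOf {K₀ K B₀ A₀ B A : C} {k₀ : K₀ ⟶ B₀} {k : K ⟶ B} {f₀ : B₀ ⟶ A₀}
    {f : B ⟶ A} (hf₀ : IsRegularEpi f₀) (hf : IsRegularEpi f) (hk₀ : IsKernelOf k₀ f₀)
    (hk : IsKernelOf k f) (u : K₀ ⟶ K) (b : B₀ ⟶ B) (a : A₀ ⟶ A) (hu : u ≫ k = k₀ ≫ b)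
    (hb : b ≫ f = f₀ ≫ a) [IsIso u] [IsIso a] : IsIso b := by
  obtain ⟨e₀, he₀⟩ := (isKernelOf_kernel_ι f₀).exists_iso hk₀
  obtain ⟨e, he⟩ := hk.exists_iso (isKernelOf_kernel_ι f)
  exact SemiAbelian.short_five f₀ f (e₀.hom ≫ u ≫ e.hom) b a (by
    rw [Category.assoc, Category.assoc, he, hu, ← Category.assoc, he₀]) hb

lemma mono_of_isZero_kernel {K X Y : C} {k : K ⟶ X} {f : X ⟶ Y} (hk : IsKernelOf k f)
    (hK : IsZero K) : Mono f := by
  have hR := IsPullback.of_hasPullback f f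
  obtain ⟨k', -, -, hk'⟩ := hk.exists_of_isPullback hR
  let d : X ⟶ pullback f f := hR.lift (𝟙 X) (𝟙 X) rfl
  have hd₁ : d ≫ pullback.fst f f = 𝟙 X := hR.lift_fst _ _ _
  have hd₂ : d ≫ pullback.snd f f = 𝟙 X := hR.lift_snd _ _ _
  -- The diagonal is an isomorphism, by the Short Five Lemma over the identity of `X`.
  have : IsIso d := isIso_of_isKernelOf (f₀ := 𝟙 X) inferInstance
    (isRegularEpi_of_section _ d hd₂) (isKernelOf_zero_of_mono hK (𝟙 X)) hk' (𝟙 K) d (𝟙 X)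
    (hK.eq_of_src _ _) (by rw [hd₂]; simp)
  refine (IsKernelPair.of_hasPullback f).mono_of_eq_fst_snd ?_
  rw [← cancel_epi d, hd₁, hd₂]

/-- If `c ≫ p` is a regular epimorphism and `c` induces a regular epimorphism between the kernels
of `c ≫ p` and `p`, then `c` is a regular epimorphism. -/
lemma isRegularEpi_of_kernel_map {K L X P Y : C} {c : X ⟶ P} {p : P ⟶ Y} {f : X ⟶ Y}
    (hc : c ≫ p = f) (hf : IsRegularEpi f) {k : K ⟶ X} {l : L ⟶ P} (hk : IsKernelOf k f)
    (hl : IsKernelOf l p) {u : K ⟶ L} (hu : u ≫ l = k ≫ c) (hu' : IsRegularEpi u) :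
    IsRegularEpi c := by
  obtain ⟨M, e, m, he, hm, rfl⟩ := exists_image c
  have hmp : IsRegularEpi (m ≫ p) := isRegularEpi_of_comp (f := e) (by rwa [← Category.assoc, hc])
  have hp : IsRegularEpi p := isRegularEpi_of_comp hmp
  have hi := isKernelOf_kernel_ι (m ≫ p)
  obtain ⟨s, hs⟩ := hl.exists_lift (kernel.ι (m ≫ p) ≫ m) (by rw [Category.assoc, hi.w])
  obtain ⟨t, ht⟩ := hi.exists_lift (k ≫ e) (by
    rw [Category.assoc, ← Category.assoc e, hc, hk.w])
  have := hl.mono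
  have hts : t ≫ s = u := by
    rw [← cancel_mono l, hu, Category.assoc, hs, ← Category.assoc, ht, Category.assoc]
  have hs₁ : IsRegularEpi s := isRegularEpi_of_comp (f := t) (by rwa [hts])
  have hs₂ : Mono s := by
    have : Mono (s ≫ l) := by rw [hs]; infer_instance
    exact mono_of_mono s l
  have := isIso_of_isRegularEpi_of_mono hs₁ hs₂
  have : IsIso m := isIso_of_isKernelOf hmp hp hi hl s m (𝟙 Y) hs (by simp)
  exact isRegularEpi_comp he inferInstance

/-- A regular epimorphism is a cokernel of its kernel. -/
lemma exists_desc_of_isKernelOf {K X Y T : C} {k : K ⟶ X} {f : X ⟶ Y} (hf : IsRegularEpi f)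
    (hk : IsKernelOf k f) (t : X ⟶ T) (ht : k ≫ t = 0) : ∃ l : Y ⟶ T, f ≫ l = t := by
  obtain ⟨M, e, m, he, hm, hem⟩ := exists_image (prod.lift f t)
  have hf' : e ≫ m ≫ prod.fst = f := by rw [← Category.assoc, hem, prod.lift_fst]
  have ht' : e ≫ m ≫ prod.snd = t := by rw [← Category.assoc, hem, prod.lift_snd]
  have hp : IsRegularEpi (m ≫ prod.fst) := isRegularEpi_of_comp (f := e) (by rwa [hf'])
  have hi := isKernelOf_kernel_ι (m ≫ (prod.fst : Y ⨯ T ⟶ Y))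
  obtain ⟨u, hu⟩ := hi.exists_lift (k ≫ e) (by rw [Category.assoc, hf', hk.w])
  have hu' : IsRegularEpi u :=
    isRegularEpi_of_isPullback (IsKernelOf.isPullback_map hf' hk hi hu) he
  -- The morphism `k ≫ (f, t)` vanishes, so the image of `(f, t)` is the graph of a morphism.
  have hke : k ≫ e = 0 := by
    rw [← cancel_mono m, Category.assoc, hem, zero_comp]
    ext <;> simp [prod.lift_fst, prod.lift_snd, hk.w, ht]
  have : Mono (m ≫ (prod.fst : Y ⨯ T ⟶ Y)) := by
    refine mono_of_isZero_kernel hi (isZero_of_epi_zero u ?_)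
    rw [← cancel_mono (kernel.ι (m ≫ (prod.fst : Y ⨯ T ⟶ Y))), hu, hke, zero_comp]
  have := isIso_of_isRegularEpi_of_mono hp this
  exact ⟨inv (m ≫ prod.fst) ≫ m ≫ prod.snd, by
    rw [← hf', Category.assoc, Category.assoc, ← Category.assoc m, IsIso.hom_inv_id_assoc, ht']⟩

lemma isRegularEpi_cokernel_π {X Y : C} (f : X ⟶ Y) : IsRegularEpi (cokernel.π f) :=
  ⟨⟨{ W := _, left := f, right := 0, w := coequalizer.condition _ _,
      isColimit := coequalizerIsCoequalizer _ _ }⟩⟩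

/-- Regular images of normal monomorphisms are normal: if `n` is a kernel of `c` and `q` is a
regular epimorphism, then `n ≫ q` covers the kernel of its cokernel. -/
lemma isRegularEpi_to_kernel_cokernel {N R Q B : C} {n : N ⟶ R} {c : R ⟶ Q} (hn : IsKernelOf n c)
    {q : R ⟶ B} (hq : IsRegularEpi q) :
    IsRegularEpi (kernel.lift (cokernel.π (n ≫ q)) (n ≫ q) (cokernel.condition _)) := by
  -- `U` is the image of `R` in `B × Q`, with projections `r₁` and `r₂`.
  obtain ⟨U, e, m, he, hm, hem⟩ := exists_image (prod.lift q c)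
  let r₁ : U ⟶ B := m ≫ prod.fst
  let r₂ : U ⟶ Q := m ≫ prod.snd
  have e₁ : e ≫ r₁ = q := by rw [← Category.assoc, hem, prod.lift_fst]
  have e₂ : e ≫ r₂ = c := by rw [← Category.assoc, hem, prod.lift_snd]
  have hr : ∀ {T : C} (a b : T ⟶ U), a ≫ r₁ = b ≫ r₁ → a ≫ r₂ = b ≫ r₂ → a = b := by
    intro T a b h₁ h₂
    rw [← cancel_mono m]
    ext
    · simpa [r₁] using h₁
    · simpa [r₂] using h₂
  -- The relation `U` is difunctional.
  have hdif : ∀ {W : C} (x y z : W ⟶ U), x ≫ r₂ = y ≫ r₂ → y ≫ r₁ = z ≫ r₁ →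
      ∃ d : W ⟶ U, d ≫ r₁ = x ≫ r₁ ∧ d ≫ r₂ = z ≫ r₂ := by
    intro W x y z h₂ h₁
    let s₁ : U ⟶ B ⨯ Q := r₁ ≫ prod.lift (𝟙 B) 0
    let s₂ : U ⟶ B ⨯ Q := r₂ ≫ prod.lift 0 (𝟙 Q)
    have t₁ : s₁ ≫ prod.fst = r₁ := by simp [s₁, prod.lift_fst]
    have t₂ : s₂ ≫ prod.snd = r₂ := by simp [s₂, prod.lift_snd]
    have : Mono (prod.lift s₁ s₂) := ⟨fun a b hab => by
      have h₁ := congrArg (· ≫ prod.fst ≫ prod.fst) hab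
      have h₂ := congrArg (· ≫ prod.snd ≫ prod.snd) hab
      simp only [Category.assoc, prod.lift_fst_assoc, prod.lift_snd_assoc, t₁, t₂] at h₁ h₂
      exact hr a b h₁ h₂⟩
    obtain ⟨d, hd₁, hd₂⟩ := difunctional s₁ s₂ x y z
      (by simp only [s₂, ← Category.assoc, h₂]) (by simp only [s₁, ← Category.assoc, h₁])
    refine ⟨d, ?_, ?_⟩
    · simpa only [Category.assoc, t₁] using congrArg (· ≫ prod.fst) hd₁
    · simpa only [Category.assoc, t₂] using congrArg (· ≫ prod.snd) hd₂
  -- `S` is the relation on `B` induced by the kernel pair of `r₂`.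
  obtain ⟨S, g, i, hg, hi, hgi⟩ := exists_image
    (prod.lift (pullback.fst r₂ r₂ ≫ r₁) (pullback.snd r₂ r₂ ≫ r₁))
  let s₁ : S ⟶ B := i ≫ prod.fst
  let s₂ : S ⟶ B := i ≫ prod.snd
  have g₁ : g ≫ s₁ = pullback.fst r₂ r₂ ≫ r₁ := by rw [← Category.assoc, hgi, prod.lift_fst]
  have g₂ : g ≫ s₂ = pullback.snd r₂ r₂ ≫ r₁ := by rw [← Category.assoc, hgi, prod.lift_snd]
  have hsi : prod.lift s₁ s₂ = i := by ext <;> simp [s₁, s₂, prod.lift_fst, prod.lift_snd]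
  have hS : Mono (prod.lift s₁ s₂) := by rwa [hsi]
  have hr₁ : IsRegularEpi r₁ := isRegularEpi_of_comp (f := e) (by rwa [e₁])
  -- The diagonal of `U` descends to the diagonal of `B`.
  obtain ⟨δ, hδ⟩ : ∃ δ : B ⟶ S, δ ≫ i = prod.lift (𝟙 B) (𝟙 B) := by
    have hsq : CommSq (pullback.lift (𝟙 U) (𝟙 U) rfl ≫ g) r₁ i (prod.lift (𝟙 B) (𝟙 B)) := ⟨by
      ext
      · rw [Category.assoc, Category.assoc, g₁, pullback.lift_fst_assoc]
        simp [prod.lift_fst]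
      · rw [Category.assoc, Category.assoc, g₂, pullback.lift_snd_assoc]
        simp [prod.lift_snd]⟩
    have : StrongEpi r₁ := inferInstance
    exact ⟨hsq.lift, hsq.fac_right⟩
  have : IsEquivalenceRelation s₁ s₂ := isEquivalenceRelation_of_reflexive s₁ s₂ δ
    (by simp only [s₁]; rw [← Category.assoc, hδ, prod.lift_fst])
    (by simp only [s₂]; rw [← Category.assoc, hδ, prod.lift_snd])
  obtain ⟨D, d, hd⟩ := BarrExact.isKernelPair_of_equivalenceRelation s₁ s₂
  -- `d` coequalizes the relation `S`, hence vanishes on `N`.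
  have hnd : (n ≫ q) ≫ d = 0 := by
    let a : N ⟶ pullback r₂ r₂ := pullback.lift 0 (n ≫ e) (by
      rw [zero_comp, Category.assoc, e₂, hn.w])
    have h := congrArg (fun t => a ≫ g ≫ t) hd.w
    simp only [← Category.assoc] at h
    rw [Category.assoc a g s₁, Category.assoc a g s₂, g₁, g₂, ← Category.assoc a,
      ← Category.assoc a, pullback.lift_fst, pullback.lift_snd, zero_comp, zero_comp,
      Category.assoc n, e₁] at h
    exact h.symm
  set π := cokernel.π (n ≫ q) with hπ
  have hκd : kernel.ι π ≫ d = 0 := by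
    rw [← cokernel.π_desc (n ≫ q) d hnd, ← Category.assoc, kernel.condition, zero_comp]
  -- Hence a point of the kernel of `π` is `S`-related to zero.
  obtain ⟨t, ht₁, ht₂⟩ : ∃ t : kernel π ⟶ S, t ≫ s₁ = 0 ∧ t ≫ s₂ = kernel.ι π :=
    ⟨hd.lift 0 (kernel.ι π) (by rw [hκd, zero_comp]), hd.lift_fst _ _ _, hd.lift_snd _ _ _⟩
  let K₁ := pullback g t
  let c₁ : K₁ ⟶ kernel π := pullback.snd g t
  let x : K₁ ⟶ U := pullback.fst g t ≫ pullback.fst r₂ r₂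
  let y : K₁ ⟶ U := pullback.fst g t ≫ pullback.snd r₂ r₂
  have hx : x ≫ r₁ = 0 := by
    simp only [x]
    rw [Category.assoc, ← g₁, ← Category.assoc, pullback.condition, Category.assoc, ht₁, comp_zero]
  have hy : y ≫ r₁ = c₁ ≫ kernel.ι π := by
    simp only [y]
    rw [Category.assoc, ← g₂, ← Category.assoc, pullback.condition, Category.assoc, ht₂]
  obtain ⟨z, hz₁, hz₂⟩ := hdif y x 0 (by simp [x, y, pullback.condition]) (by rw [hx, zero_comp])
  rw [zero_comp] at hz₂
  have hc₂ : (pullback.fst e z ≫ c) = 0 := by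
    rw [← e₂, ← Category.assoc, pullback.condition, Category.assoc, hz₂, comp_zero]
  obtain ⟨l, hl⟩ := hn.exists_lift _ hc₂
  have hfin : l ≫ kernel.lift π (n ≫ q) (cokernel.condition _) = pullback.snd e z ≫ c₁ := by
    rw [← cancel_mono (kernel.ι π), Category.assoc, kernel.lift_ι, ← Category.assoc, hl,
      Category.assoc, ← hy, ← hz₁, ← Category.assoc, ← pullback.condition, Category.assoc, e₁]
  refine isRegularEpi_of_comp (f := l) ?_
  rw [hfin]
  exact isRegularEpi_comp inferInstance inferInstance

/-- A monomorphism which is the regular image of a normal monomorphism is normal. -/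
lemma isKernelOf_cokernel_of_image {N R Q B : C} {n : N ⟶ R} {c : R ⟶ Q} (hn : IsKernelOf n c)
    {q : R ⟶ B} (hq : IsRegularEpi q) {m : N ⟶ B} [hm : Mono m] (h : n ≫ q = m) :
    IsKernelOf m (cokernel.π m) := by
  subst h
  let t := kernel.lift (cokernel.π (n ≫ q)) (n ≫ q) (cokernel.condition _)
  have ht : t ≫ kernel.ι (cokernel.π (n ≫ q)) = n ≫ q := kernel.lift_ι _ _ _
  have : Mono t := by
    have : Mono (t ≫ kernel.ι (cokernel.π (n ≫ q))) := by rwa [ht]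
    exact mono_of_mono t (kernel.ι (cokernel.π (n ≫ q)))
  have : IsIso t := isIso_of_isRegularEpi_of_mono (isRegularEpi_to_kernel_cokernel hn hq) this
  have h := (isKernelOf_kernel_ι (cokernel.π (n ≫ q))).iso_comp t
  rwa [ht] at h

end SemiAbelian

/-! ### Kernels in a square of regular epimorphisms -/

section Squares

variable {C : Type u} [Category.{v} C] [HasZeroMorphisms C]

/-- Consider a commutative square `x ≫ f₀ = f₁ ≫ y`, with comparison `c` to the pullback of `y` and
`f₀`. The morphism between the kernels of `f₁` and `f₀` is a pullback of `c`. -/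
lemma exists_isPullback_kernels {X₁ X₀ Y₁ Y₀ P K₁ K₀ : C} {x : X₁ ⟶ X₀} {f₁ : X₁ ⟶ Y₁}
    {f₀ : X₀ ⟶ Y₀} {y : Y₁ ⟶ Y₀} {p : P ⟶ Y₁} {q : P ⟶ X₀} (hP : IsPullback p q y f₀)
    {c : X₁ ⟶ P} (hcp : c ≫ p = f₁) (hcq : c ≫ q = x) {k₁ : K₁ ⟶ X₁} {k₀ : K₀ ⟶ X₀}
    (hk₁ : IsKernelOf k₁ f₁) (hk₀ : IsKernelOf k₀ f₀) {u : K₁ ⟶ K₀} (hu : u ≫ k₀ = k₁ ≫ x) :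
    ∃ k' : K₀ ⟶ P, IsPullback k₁ u c k' ∧ IsKernelOf k' p ∧ u ≫ k' = k₁ ≫ c := by
  obtain ⟨k', hq, hp, hk'⟩ := hk₀.exists_of_isPullback hP.flip
  have hu' : u ≫ k' = k₁ ≫ c := by
    apply hP.hom_ext
    · rw [Category.assoc, hp, comp_zero, Category.assoc, hcp, hk₁.w]
    · rw [Category.assoc, hq, Category.assoc, hcq, hu]
  exact ⟨k', IsKernelOf.isPullback_map hcp hk₁ hk' hu', hk', hu'⟩

/-- The two morphisms between kernels of opposite sides of a square have the same kernel. -/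
lemma exists_isKernelOf_transpose [HasPullbacks C] {X₁ X₀ Y₁ Y₀ K₁ K₀ L₁ L₀ N : C} {x : X₁ ⟶ X₀}
    {f₁ : X₁ ⟶ Y₁} {f₀ : X₀ ⟶ Y₀} {y : Y₁ ⟶ Y₀} (sq : x ≫ f₀ = f₁ ≫ y) {k₁ : K₁ ⟶ X₁}
    {k₀ : K₀ ⟶ X₀} (hk₁ : IsKernelOf k₁ f₁) (hk₀ : IsKernelOf k₀ f₀) {u : K₁ ⟶ K₀}
    (hu : u ≫ k₀ = k₁ ≫ x) {l₁ : L₁ ⟶ X₁} {l₀ : L₀ ⟶ Y₁} (hl₁ : IsKernelOf l₁ x)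
    (hl₀ : IsKernelOf l₀ y) {v : L₁ ⟶ L₀} (hv : v ≫ l₀ = l₁ ≫ f₁) {n : N ⟶ K₁}
    (hn : IsKernelOf n u) : ∃ n' : N ⟶ L₁, IsKernelOf n' v := by
  have hP := IsPullback.of_hasPullback y f₀
  obtain ⟨_, h₁, -, -⟩ := exists_isPullback_kernels hP (hP.lift_fst f₁ x sq.symm)
    (hP.lift_snd f₁ x sq.symm) hk₁ hk₀ hu
  obtain ⟨_, h₂, -, -⟩ := exists_isPullback_kernels hP.flip (hP.lift_snd f₁ x sq.symm)
    (hP.lift_fst f₁ x sq.symm) hl₁ hl₀ hv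
  obtain ⟨n', -, -, hn'⟩ := (hn.map_isPullback h₁).exists_of_isPullback h₂
  exact ⟨n', hn'⟩

variable [SemiAbelian C]

/-- In a square whose side `f₁` is a regular epimorphism, the comparison to the pullback is a
regular epimorphism as soon as the morphism between the kernels of `f₁` and `f₀` is. -/
lemma isRegularEpi_comparison {X₁ X₀ Y₁ Y₀ P K₁ K₀ : C} {x : X₁ ⟶ X₀} {f₁ : X₁ ⟶ Y₁}
    {f₀ : X₀ ⟶ Y₀} {y : Y₁ ⟶ Y₀} {p : P ⟶ Y₁} {q : P ⟶ X₀} (hP : IsPullback p q y f₀)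
    {c : X₁ ⟶ P} (hcp : c ≫ p = f₁) (hcq : c ≫ q = x) {k₁ : K₁ ⟶ X₁} {k₀ : K₀ ⟶ X₀}
    (hk₁ : IsKernelOf k₁ f₁) (hk₀ : IsKernelOf k₀ f₀) {u : K₁ ⟶ K₀} (hu : u ≫ k₀ = k₁ ≫ x)
    (hf₁ : IsRegularEpi f₁) (hu' : IsRegularEpi u) : IsRegularEpi c := by
  obtain ⟨k', -, hk', h⟩ := exists_isPullback_kernels hP hcp hcq hk₁ hk₀ hu
  exact isRegularEpi_of_kernel_map hcp hf₁ hk₁ hk' h hu'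

/-- If `f₁` and the morphism between the kernels of `f₁` and `f₀` are regular epimorphisms, then so
is the morphism between the kernels of the other two sides. -/
lemma isRegularEpi_kernel_transpose {X₁ X₀ Y₁ Y₀ K₁ K₀ L₁ L₀ : C} {x : X₁ ⟶ X₀}
    {f₁ : X₁ ⟶ Y₁} {f₀ : X₀ ⟶ Y₀} {y : Y₁ ⟶ Y₀} (sq : x ≫ f₀ = f₁ ≫ y) {k₁ : K₁ ⟶ X₁}
    {k₀ : K₀ ⟶ X₀} (hk₁ : IsKernelOf k₁ f₁) (hk₀ : IsKernelOf k₀ f₀) {u : K₁ ⟶ K₀}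
    (hu : u ≫ k₀ = k₁ ≫ x) {l₁ : L₁ ⟶ X₁} {l₀ : L₀ ⟶ Y₁} (hl₁ : IsKernelOf l₁ x)
    (hl₀ : IsKernelOf l₀ y) {v : L₁ ⟶ L₀} (hv : v ≫ l₀ = l₁ ≫ f₁) (hf₁ : IsRegularEpi f₁)
    (hu' : IsRegularEpi u) : IsRegularEpi v := by
  have hP := IsPullback.of_hasPullback y f₀
  have hc := isRegularEpi_comparison hP (hP.lift_fst f₁ x sq.symm) (hP.lift_snd f₁ x sq.symm)
    hk₁ hk₀ hu hf₁ hu'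
  obtain ⟨_, h₂, -, -⟩ := exists_isPullback_kernels hP.flip (hP.lift_snd f₁ x sq.symm)
    (hP.lift_fst f₁ x sq.symm) hl₁ hl₀ hv
  exact isRegularEpi_of_isPullback h₂ hc

/-- The Short Five Lemma for regular epimorphisms. -/
lemma isRegularEpi_of_kernel_of_quotient {X₁ X₀ Y₁ Y₀ K₁ K₀ : C} {x : X₁ ⟶ X₀}
    {f₁ : X₁ ⟶ Y₁} {f₀ : X₀ ⟶ Y₀} {y : Y₁ ⟶ Y₀} (sq : x ≫ f₀ = f₁ ≫ y) {k₁ : K₁ ⟶ X₁}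
    {k₀ : K₀ ⟶ X₀} (hk₁ : IsKernelOf k₁ f₁) (hk₀ : IsKernelOf k₀ f₀) {u : K₁ ⟶ K₀}
    (hu : u ≫ k₀ = k₁ ≫ x) (hf₁ : IsRegularEpi f₁) (hu' : IsRegularEpi u)
    (hy : IsRegularEpi y) : IsRegularEpi x := by
  have hP := IsPullback.of_hasPullback y f₀
  have hc := isRegularEpi_comparison hP (hP.lift_fst f₁ x sq.symm) (hP.lift_snd f₁ x sq.symm)
    hk₁ hk₀ hu hf₁ hu'
  rw [← hP.lift_snd f₁ x sq.symm]
  exact isRegularEpi_comp hc (isRegularEpi_of_isPullback hP hy)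

end Squares

/-! ### The category of arrows of a semi-abelian category -/

section ArrowCategory

variable {C : Type u} [Category.{v} C]

lemma comp_left_eq {X Y Z : Arrow C} {φ : X ⟶ Y} {ψ : Y ⟶ Z} {χ : X ⟶ Z} (h : φ ≫ ψ = χ) :
    φ.left ≫ ψ.left = χ.left := by
  rw [← h, Arrow.comp_left]

lemma comp_right_eq {X Y Z : Arrow C} {φ : X ⟶ Y} {ψ : Y ⟶ Z} {χ : X ⟶ Z} (h : φ ≫ ψ = χ) :
    φ.right ≫ ψ.right = χ.right := by
  rw [← h, Arrow.comp_right]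

lemma isPullback_arrow_of_components {P X Y W : Arrow C} {p : P ⟶ X} {q : P ⟶ W} {f : X ⟶ Y}
    {g : W ⟶ Y} (hl : IsPullback p.left q.left f.left g.left)
    (hr : IsPullback p.right q.right f.right g.right) : IsPullback p q f g := by
  have hs (s : PullbackCone f g) : ∃ t : s.pt ⟶ P, t ≫ p = s.fst ∧ t ≫ q = s.snd := by
    have w₁ : s.fst.left ≫ f.left = s.snd.left ≫ g.left := congrArg Arrow.Hom.left s.condition
    have w₀ : s.fst.right ≫ f.right = s.snd.right ≫ g.right :=
      congrArg Arrow.Hom.right s.condition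
    refine ⟨Arrow.homMk (hl.lift s.fst.left s.snd.left w₁) (hr.lift s.fst.right s.snd.right w₀) ?_,
      ?_, ?_⟩
    · apply hr.hom_ext
      · rw [Category.assoc, Category.assoc, hr.lift_fst, ← Arrow.w p, ← Category.assoc,
          hl.lift_fst, Arrow.w]
      · rw [Category.assoc, Category.assoc, hr.lift_snd, ← Arrow.w q, ← Category.assoc,
          hl.lift_snd, Arrow.w]
    · ext
      exacts [hl.lift_fst _ _ _, hr.lift_fst _ _ _]
    · ext
      exacts [hl.lift_snd _ _ _, hr.lift_snd _ _ _]
  refine ⟨⟨by ext; exacts [hl.w, hr.w]⟩, ⟨PullbackCone.IsLimit.mk _ (fun s => (hs s).choose)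
    (fun s => (hs s).choose_spec.1) (fun s => (hs s).choose_spec.2) (fun s m h₁ h₂ => ?_)⟩⟩
  have h₁' := h₁.trans (hs s).choose_spec.1.symm
  have h₂' := h₂.trans (hs s).choose_spec.2.symm
  ext
  · exact hl.hom_ext (comp_left_eq h₁') (comp_left_eq h₂')
  · exact hr.hom_ext (comp_right_eq h₁') (comp_right_eq h₂')

lemma isPullback_arrow_components [HasPullbacks C] {P X Y W : Arrow C} {p : P ⟶ X} {q : P ⟶ W}
    {f : X ⟶ Y} {g : W ⟶ Y} (h : IsPullback p q f g) :
    IsPullback p.left q.left f.left g.left ∧ IsPullback p.right q.right f.right g.right := by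
  have hl := IsPullback.of_hasPullback f.left g.left
  have hr := IsPullback.of_hasPullback f.right g.right
  let Q : Arrow C := Arrow.mk (hr.lift (pullback.fst _ _ ≫ X.hom) (pullback.snd _ _ ≫ W.hom) (by
    rw [Category.assoc, Category.assoc, ← Arrow.w f, ← Arrow.w g, ← Category.assoc, hl.w,
      Category.assoc]))
  have h' : IsPullback (Arrow.homMk (pullback.fst _ _) (pullback.fst _ _)
      (hr.lift_fst _ _ _).symm : Q ⟶ X) (Arrow.homMk (pullback.snd _ _) (pullback.snd _ _)
      (hr.lift_snd _ _ _).symm : Q ⟶ W) f g := isPullback_arrow_of_components hl hr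
  let e := h.isoIsPullback _ _ h'
  have e₁ := h.isoIsPullback_hom_fst _ _ h'
  have e₂ := h.isoIsPullback_hom_snd _ _ h'
  let el : P.left ≅ pullback f.left g.left := Arrow.leftFunc.mapIso e
  let er : P.right ≅ pullback f.right g.right := Arrow.rightFunc.mapIso e
  exact ⟨IsPullback.of_iso_pullback ⟨congrArg Arrow.Hom.left h.w⟩ el (comp_left_eq e₁)
      (comp_left_eq e₂),
    IsPullback.of_iso_pullback ⟨congrArg Arrow.Hom.right h.w⟩ er (comp_right_eq e₁)
      (comp_right_eq e₂)⟩

section Kernels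

variable [HasZeroMorphisms C]

lemma isKernelOf_arrow_of_components {K X Y : Arrow C} {k : K ⟶ X} {f : X ⟶ Y}
    (hl : IsKernelOf k.left f.left) (hr : IsKernelOf k.right f.right) : IsKernelOf k f := by
  have := hl.mono
  have := hr.mono
  refine ⟨⟨fun a b hab => ?_⟩, ?_, fun t ht => ?_⟩
  · ext
    · rw [← cancel_mono k.left]; exact congrArg Arrow.Hom.left hab
    · rw [← cancel_mono k.right]; exact congrArg Arrow.Hom.right hab
  · ext
    exacts [hl.w, hr.w]
  · obtain ⟨a, ha⟩ := hl.exists_lift t.left (congrArg Arrow.Hom.left ht)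
    obtain ⟨b, hb⟩ := hr.exists_lift t.right (congrArg Arrow.Hom.right ht)
    refine ⟨Arrow.homMk a b ?_, by ext; exacts [ha, hb]⟩
    rw [← cancel_mono k.right, Category.assoc, Category.assoc, hb, ← Arrow.w k, ← Category.assoc,
      ha, Arrow.w]

lemma isKernelOf_arrow_components [HasKernels C] {K X Y : Arrow C} {k : K ⟶ X} {f : X ⟶ Y}
    (h : IsKernelOf k f) : IsKernelOf k.left f.left ∧ IsKernelOf k.right f.right := by
  have h' : IsKernelOf (Arrow.homMk (kernel.ι f.left) (kernel.ι f.right) (by simp) :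
      Arrow.mk (kernel.map f.left f.right X.hom Y.hom (Arrow.w f)) ⟶ X) f :=
    isKernelOf_arrow_of_components (isKernelOf_kernel_ι _) (isKernelOf_kernel_ι _)
  obtain ⟨e, he⟩ := h.exists_iso h'
  rw [← he]
  exact ⟨(isKernelOf_kernel_ι f.left).iso_comp e.hom.left,
    (isKernelOf_kernel_ι f.right).iso_comp e.hom.right⟩

lemma isZero_arrow_iff [HasZeroObject C] {X : Arrow C} :
    IsZero X ↔ IsZero X.left ∧ IsZero X.right := by
  simp only [IsZero.iff_id_eq_zero]
  exact ⟨fun h => ⟨congrArg Arrow.Hom.left h, congrArg Arrow.Hom.right h⟩,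
    fun h => by ext; exacts [h.1, h.2]⟩

end Kernels

lemma isRegularEpi_arrow_of_components [HasPullbacks C] {X Y : Arrow C} {f : X ⟶ Y}
    (hl : IsRegularEpi f.left) (hr : IsRegularEpi f.right) : IsRegularEpi f := by
  have h := isPullback_arrow_components (IsPullback.of_hasPullback f f)
  have hl' : IsKernelPair f.left _ _ := h.1
  have hr' : IsKernelPair f.right _ _ := h.2
  have := fun (s : Cofork (pullback.fst f f) (pullback.snd f f)) =>
    IsRegularEpi.exists_of_isKernelPair f.left hl' s.π.left (congrArg Arrow.Hom.left s.condition)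
  choose a ha using this
  have := fun (s : Cofork (pullback.fst f f) (pullback.snd f f)) =>
    IsRegularEpi.exists_of_isKernelPair f.right hr' s.π.right
      (congrArg Arrow.Hom.right s.condition)
  choose b hb using this
  refine ⟨⟨{ W := _, left := pullback.fst f f, right := pullback.snd f f,
             w := pullback.condition,
             isColimit := Cofork.IsColimit.mk _ (fun s => Arrow.homMk (a s) (b s) ?_) ?_ ?_ }⟩⟩
  · rw [← cancel_epi f.left, ← Category.assoc, ha]
    exact (Arrow.w s.π).trans (by
      rw [← hb, ← Category.assoc, ← Arrow.w f, Category.assoc]; rfl)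
  · intro s
    ext
    exacts [ha s, hb s]
  · intro s m hm
    ext
    · rw [← cancel_epi f.left]; exact (congrArg Arrow.Hom.left hm).trans (ha s).symm
    · rw [← cancel_epi f.right]; exact (congrArg Arrow.Hom.right hm).trans (hb s).symm

lemma isRegularEpi_arrow_components [Regular C] {X Y : Arrow C} {f : X ⟶ Y} (h : IsRegularEpi f) :
    IsRegularEpi f.left ∧ IsRegularEpi f.right := by
  obtain ⟨M₁, e₁, m₁, he₁, hm₁, h₁⟩ := exists_image f.left
  obtain ⟨M₀, e₀, m₀, he₀, hm₀, h₀⟩ := exists_image f.right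
  have hsq : CommSq (X.hom ≫ e₀) e₁ m₀ (m₁ ≫ Y.hom) := ⟨by
    rw [Category.assoc, h₀, ← Category.assoc, h₁, Arrow.w]⟩
  have : StrongEpi e₁ := inferInstance
  let e : X ⟶ Arrow.mk hsq.lift := Arrow.homMk e₁ e₀ hsq.fac_left
  let m : Arrow.mk hsq.lift ⟶ Y := Arrow.homMk m₁ m₀ hsq.fac_right.symm
  have hem : e ≫ m = f := by ext; exacts [h₁, h₀]
  have hm : Mono m := ⟨fun a b hab => by
    ext
    · rw [← cancel_mono m₁]; exact congrArg Arrow.Hom.left hab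
    · rw [← cancel_mono m₀]; exact congrArg Arrow.Hom.right hab⟩
  have : StrongEpi (e ≫ m) := by rw [hem]; infer_instance
  have : StrongEpi m := strongEpi_of_strongEpi e m
  have : IsIso m := isIso_of_mono_of_strongEpi m
  have h₁' : IsIso m₁ := inferInstanceAs (IsIso m.left)
  have h₀' : IsIso m₀ := inferInstanceAs (IsIso m.right)
  rw [← h₁, ← h₀]
  exact ⟨isRegularEpi_comp he₁ inferInstance, isRegularEpi_comp he₀ inferInstance⟩

variable [HasZeroMorphisms C] [SemiAbelian C]

lemma exists_isRegularEpi_isKernelPair {R X : C} (p₁ p₂ : R ⟶ X) [IsEquivalenceRelation p₁ p₂] :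
    ∃ (Y : C) (f : X ⟶ Y), IsRegularEpi f ∧ IsKernelPair f p₁ p₂ := by
  obtain ⟨Y, f, hf⟩ := BarrExact.isKernelPair_of_equivalenceRelation p₁ p₂
  obtain ⟨M, e, m, he, hm, rfl⟩ := exists_image f
  exact ⟨M, e, he, hf.cancel_right_of_mono⟩

/-- Arrows in a semi-abelian category form a semi-abelian category. -/
instance arrowSemiAbelian : SemiAbelian (Arrow C) where
  hasCoequalizer_of_isKernelPair _ := inferInstance
  regularEpiIsStableUnderBaseChange := ⟨fun {_ _ _ _ _ _ _ _} h hf => by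
    have h' := isPullback_arrow_components h
    have hf' := isRegularEpi_arrow_components hf
    exact isRegularEpi_arrow_of_components (isRegularEpi_of_isPullback h'.1 hf'.1)
      (isRegularEpi_of_isPullback h'.2 hf'.2)⟩
  isKernelPair_of_equivalenceRelation {R X} p₁ p₂ h := by
    obtain ⟨⟨E⟩⟩ := h
    have hl : Mono (prod.lift p₁.left p₂.left) := ⟨fun {T} a b hab => by
      have h₁ := congrArg (· ≫ prod.fst) hab
      have h₂ := congrArg (· ≫ prod.snd) hab
      simp only [Category.assoc, prod.lift_fst, prod.lift_snd] at h₁ h₂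
      refine congrArg Arrow.Hom.left (E.right_cancellation
        (Arrow.homMk a (a ≫ R.hom) : Arrow.mk (𝟙 T) ⟶ R) (Arrow.homMk b (b ≫ R.hom)) ?_ ?_)
      · ext
        · exact h₁
        · simp [← Arrow.w, reassoc_of% h₁]
      · ext
        · exact h₂
        · simp [← Arrow.w, reassoc_of% h₂]⟩
    have hr : Mono (prod.lift p₁.right p₂.right) := ⟨fun {T} a b hab => by
      have h₁ := congrArg (· ≫ prod.fst) hab
      have h₂ := congrArg (· ≫ prod.snd) hab
      simp only [Category.assoc, prod.lift_fst, prod.lift_snd] at h₁ h₂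
      open ZeroObject in
      refine congrArg Arrow.Hom.right (E.right_cancellation
        (Arrow.homMk 0 a : Arrow.mk (0 : (0 : C) ⟶ T) ⟶ R) (Arrow.homMk 0 b) ?_ ?_)
      · ext
        · simp
        · exact h₁
      · ext
        · simp
        · exact h₂⟩
    have := isEquivalenceRelation_of_reflexive p₁.left p₂.left E.r.left
      (congrArg Arrow.Hom.left E.reflexivity₁) (congrArg Arrow.Hom.left E.reflexivity₂)
    have := isEquivalenceRelation_of_reflexive p₁.right p₂.right E.r.right
      (congrArg Arrow.Hom.right E.reflexivity₁) (congrArg Arrow.Hom.right E.reflexivity₂)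
    obtain ⟨Y₁, f₁, hf₁, h₁⟩ := exists_isRegularEpi_isKernelPair p₁.left p₂.left
    obtain ⟨Y₀, f₀, hf₀, h₀⟩ := exists_isRegularEpi_isKernelPair p₁.right p₂.right
    obtain ⟨y, hy⟩ := IsRegularEpi.exists_of_isKernelPair f₁ h₁ (X.hom ≫ f₀) (by
      rw [← Category.assoc, ← Category.assoc, Arrow.w, Arrow.w, Category.assoc, Category.assoc,
        h₀.w])
    exact ⟨Arrow.mk y, Arrow.homMk f₁ f₀ hy, isPullback_arrow_of_components h₁ h₀⟩
  hasZeroObject := inferInstance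
  hasBinaryCoproducts := inferInstance
  short_five {B₀ A₀ B₁ A₁} f₀ f hf₀ hf k b a hk hb _ _ := by
    have h₀ := isKernelOf_arrow_components (isKernelOf_kernel_ι f₀)
    have h := isKernelOf_arrow_components (isKernelOf_kernel_ι f)
    have e₀ := isRegularEpi_arrow_components hf₀
    have e := isRegularEpi_arrow_components hf
    have : IsIso b.left := isIso_of_isKernelOf e₀.1 e.1 h₀.1 h.1 k.left b.left a.left
      (congrArg Arrow.Hom.left hk) (congrArg Arrow.Hom.left hb)
    have : IsIso b.right := isIso_of_isKernelOf e₀.2 e.2 h₀.2 h.2 k.right b.right a.right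
      (congrArg Arrow.Hom.right hk) (congrArg Arrow.Hom.right hb)
    exact Arrow.isIso_of_isIso_left_of_isIso_right b

end ArrowCategory

/-! ### Classes of extensions -/

section ExtensionClass

variable {C : Type u} [Category.{v} C] [HasZeroMorphisms C] [SemiAbelian C]

/-- The class of extensions determined by a class `P` of objects: the regular epimorphisms whose
domain and kernel belong to `P`. -/
def extensionClass (P : ObjectProperty C) : MorphismProperty C := fun X _ f =>
  IsRegularEpi f ∧ P X ∧ P (kernel f)

/-- The closure properties of the class of `n`-extensions on which the theory rests: `P` contains
zero objects, is closed under extensions, under quotients by a kernel in `P`, and under kernels of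
split epimorphisms. -/
structure IsExtensionClosed (P : ObjectProperty C) : Prop where
  of_isZero {X : C} : IsZero X → P X
  of_extension {K X Y : C} {k : K ⟶ X} {f : X ⟶ Y} :
    IsKernelOf k f → IsRegularEpi f → P K → P Y → P X
  of_quotient {K X Y : C} {k : K ⟶ X} {f : X ⟶ Y} :
    IsKernelOf k f → IsRegularEpi f → P K → P X → P Y
  of_split {K X Y : C} {k : K ⟶ X} {f : X ⟶ Y} {s : Y ⟶ X} :
    IsKernelOf k f → s ≫ f = 𝟙 Y → P X → P Y → P K

namespace extensionClass

variable {P : ObjectProperty C}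

lemma isRegularEpi {X Y : C} {f : X ⟶ Y} (hf : extensionClass P f) : IsRegularEpi f := hf.1

lemma source {X Y : C} {f : X ⟶ Y} (hf : extensionClass P f) : P X := hf.2.1

end extensionClass

namespace IsExtensionClosed

variable {P : ObjectProperty C}

lemma of_iso (hP : IsExtensionClosed P) {X Y : C} (e : X ≅ Y) (hX : P X) : P Y :=
  hP.of_extension (isKernelOf_zero_of_mono (isZero_zero C) e.inv) inferInstance
    (hP.of_isZero (isZero_zero C)) hX

lemma mk_extension (hP : IsExtensionClosed P) {K X Y : C} {k : K ⟶ X} {f : X ⟶ Y}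
    (hk : IsKernelOf k f) (hf : IsRegularEpi f) (hX : P X) (hK : P K) : extensionClass P f :=
  ⟨hf, hX, hP.of_iso (hk.exists_iso (isKernelOf_kernel_ι f)).choose hK⟩

lemma kernel_mem (hP : IsExtensionClosed P) {K X Y : C} {k : K ⟶ X} {f : X ⟶ Y}
    (hf : extensionClass P f) (hk : IsKernelOf k f) : P K :=
  hP.of_iso ((isKernelOf_kernel_ι f).exists_iso hk).choose hf.2.2

lemma target_mem (hP : IsExtensionClosed P) {X Y : C} {f : X ⟶ Y} (hf : extensionClass P f) :
    P Y :=
  hP.of_quotient (isKernelOf_kernel_ι f) hf.1 hf.2.2 hf.2.1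

lemma extension_of_isIso (hP : IsExtensionClosed P) {X Y : C} (f : X ⟶ Y) [IsIso f] (hX : P X) :
    extensionClass P f :=
  hP.mk_extension (isKernelOf_zero_of_mono (isZero_zero C) f) inferInstance hX
    (hP.of_isZero (isZero_zero C))

/-- The kernel of a composite `f ≫ g` is an extension of the kernel of `g` by that of `f`. -/
lemma exists_kernel_comp {X Y Z K L M : C} {f : X ⟶ Y} {g : Y ⟶ Z} {k : K ⟶ X} {l : L ⟶ Y}
    {m : M ⟶ X} (hf : IsRegularEpi f) (hk : IsKernelOf k f) (hl : IsKernelOf l g)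
    (hm : IsKernelOf m (f ≫ g)) :
    ∃ (n : K ⟶ M) (u : M ⟶ L), IsKernelOf n u ∧ IsRegularEpi u := by
  obtain ⟨u, hu⟩ := hl.exists_lift (m ≫ f) (by rw [Category.assoc, hm.w])
  have h := IsKernelOf.isPullback_map rfl hm hl hu
  obtain ⟨n, -, -, hn⟩ := hk.exists_of_isPullback h
  exact ⟨n, u, hn, isRegularEpi_of_isPullback h hf⟩

lemma extension_comp (hP : IsExtensionClosed P) {X Y Z : C} {f : X ⟶ Y} {g : Y ⟶ Z}
    (hf : extensionClass P f) (hg : extensionClass P g) : extensionClass P (f ≫ g) := by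
  obtain ⟨n, u, hn, hu⟩ := exists_kernel_comp hf.1 (isKernelOf_kernel_ι f) (isKernelOf_kernel_ι g)
    (isKernelOf_kernel_ι (f ≫ g))
  exact ⟨isRegularEpi_comp hf.1 hg.1, hf.2.1, hP.of_extension hn hu hf.2.2 hg.2.2⟩

lemma extension_of_comp (hP : IsExtensionClosed P) {X Y Z : C} {f : X ⟶ Y} {g : Y ⟶ Z}
    (hf : extensionClass P f) (hfg : extensionClass P (f ≫ g)) : extensionClass P g := by
  obtain ⟨n, u, hn, hu⟩ := exists_kernel_comp hf.1 (isKernelOf_kernel_ι f) (isKernelOf_kernel_ι g)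
    (isKernelOf_kernel_ι (f ≫ g))
  exact ⟨isRegularEpi_of_comp hfg.1, hP.target_mem hf, hP.of_quotient hn hu hf.2.2 hfg.2.2⟩

lemma extension_baseChange (hP : IsExtensionClosed P) {T X Y W : C} {p : T ⟶ X} {q : T ⟶ W}
    {f : X ⟶ Y} {g : W ⟶ Y} (h : IsPullback p q f g) (hf : extensionClass P f) (hW : P W) :
    extensionClass P q := by
  obtain ⟨k, -, -, hk⟩ := (isKernelOf_kernel_ι f).exists_of_isPullback h
  have hq := isRegularEpi_of_isPullback h hf.1
  exact hP.mk_extension hk hq (hP.of_extension hk hq hf.2.2 hW) hf.2.2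

lemma extension_of_split (hP : IsExtensionClosed P) {X Y : C} {f : X ⟶ Y} {s : Y ⟶ X}
    (hs : s ≫ f = 𝟙 Y) (hX : P X) (hY : P Y) : extensionClass P f :=
  ⟨isRegularEpi_of_section f s hs, hX, hP.of_split (isKernelOf_kernel_ι f) hs hX hY⟩

end IsExtensionClosed

/-- The class of objects of the category of arrows formed by the extensions. -/
def arrowClass (P : ObjectProperty C) : ObjectProperty (Arrow C) := fun x => extensionClass P x.hom

/-- The closure properties pass from `n`-extensions to `(n+1)`-extensions. In a short exact sequence
of arrows, the kernels of the three arrows form a sequence to which the closure properties of `P`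
apply: it is exact by `isRegularEpi_kernel_transpose` and `exists_isKernelOf_transpose`. -/
lemma IsExtensionClosed.arrowClass {P : ObjectProperty C} (hP : IsExtensionClosed P) :
    IsExtensionClosed (arrowClass P) where
  of_isZero {X} hX := by
    have h := isZero_arrow_iff.1 hX
    have : IsIso X.hom := ⟨0, h.1.eq_of_src _ _, h.2.eq_of_src _ _⟩
    exact hP.extension_of_isIso X.hom (hP.of_isZero h.1)
  of_extension {K X Y k f} hk hf hK hY := by
    obtain ⟨hk₁, hk₀⟩ := isKernelOf_arrow_components hk
    obtain ⟨hf₁, hf₀⟩ := isRegularEpi_arrow_components hf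
    have hx := isKernelOf_kernel_ι X.hom
    have hy := isKernelOf_kernel_ι Y.hom
    have hx' := isRegularEpi_of_kernel_of_quotient (Arrow.w f).symm hk₁ hk₀ (Arrow.w k).symm hf₁
      hK.1 hY.1
    obtain ⟨v, hv⟩ := hy.exists_lift (kernel.ι X.hom ≫ f.left) (by
      rw [Category.assoc, Arrow.w, ← Category.assoc, kernel.condition, zero_comp])
    have hv' := isRegularEpi_kernel_transpose (Arrow.w f).symm hk₁ hk₀ (Arrow.w k).symm hx hy hv
      hf₁ hK.1
    obtain ⟨n, hn⟩ := exists_isKernelOf_transpose (Arrow.w f).symm hk₁ hk₀ (Arrow.w k).symm hx hy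
      hv (isKernelOf_kernel_ι K.hom)
    exact ⟨hx', hP.of_extension hk₁ hf₁ hK.2.1 hY.2.1,
      hP.of_extension hn hv' hK.2.2 hY.2.2⟩
  of_quotient {K X Y k f} hk hf hK hX := by
    obtain ⟨hk₁, hk₀⟩ := isKernelOf_arrow_components hk
    obtain ⟨hf₁, hf₀⟩ := isRegularEpi_arrow_components hf
    have hx := isKernelOf_kernel_ι X.hom
    have hy := isKernelOf_kernel_ι Y.hom
    have hy' : IsRegularEpi Y.hom := isRegularEpi_of_comp (f := f.left) (by
      rw [Arrow.w]; exact isRegularEpi_comp hX.1 hf₀)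
    obtain ⟨v, hv⟩ := hy.exists_lift (kernel.ι X.hom ≫ f.left) (by
      rw [Category.assoc, Arrow.w, ← Category.assoc, kernel.condition, zero_comp])
    have hv' := isRegularEpi_kernel_transpose (Arrow.w f).symm hk₁ hk₀ (Arrow.w k).symm hx hy hv
      hf₁ hK.1
    obtain ⟨n, hn⟩ := exists_isKernelOf_transpose (Arrow.w f).symm hk₁ hk₀ (Arrow.w k).symm hx hy
      hv (isKernelOf_kernel_ι K.hom)
    exact ⟨hy', hP.of_quotient hk₁ hf₁ hK.2.1 hX.2.1, hP.of_quotient hn hv' hK.2.2 hX.2.2⟩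
  of_split {K X Y k f s} hk hs hX hY := by
    obtain ⟨hk₁, hk₀⟩ := isKernelOf_arrow_components hk
    have hx := isKernelOf_kernel_ι X.hom
    have hy := isKernelOf_kernel_ι Y.hom
    have hx₁ := hx.mono
    have hy₁ := hy.mono
    have hs₁ : s.left ≫ f.left = 𝟙 _ := congrArg Arrow.Hom.left hs
    obtain ⟨v, hv⟩ := hy.exists_lift (kernel.ι X.hom ≫ f.left) (by
      rw [Category.assoc, Arrow.w, ← Category.assoc, kernel.condition, zero_comp])
    obtain ⟨t, ht⟩ := hx.exists_lift (kernel.ι Y.hom ≫ s.left) (by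
      rw [Category.assoc, Arrow.w, ← Category.assoc, kernel.condition, zero_comp])
    have htv : t ≫ v = 𝟙 _ := by
      rw [← cancel_mono (kernel.ι Y.hom), Category.assoc, hv, ← Category.assoc, ht,
        Category.assoc, hs₁, Category.comp_id, Category.id_comp]
    have hK := isRegularEpi_kernel_transpose (Arrow.w f) hx hy hv hk₁ hk₀ (Arrow.w k).symm hX.1
      (isRegularEpi_of_section v t htv)
    obtain ⟨n, hn⟩ := exists_isKernelOf_transpose (Arrow.w f) hx hy hv hk₁ hk₀ (Arrow.w k).symm
      (isKernelOf_kernel_ι v)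
    exact hP.mk_extension hn hK (hP.of_split hk₁ hs₁ hX.2.1 hY.2.1)
      (hP.of_split (isKernelOf_kernel_ι v) htv hX.2.2 hY.2.2)

/-- An `(n+2)`-extension, defined by a square, its pullback and the comparison, is the same as a
regular epimorphism of `(n+1)`-fold arrows whose domain and kernel are `(n+1)`-extensions. -/
lemma extensionClass_arrowClass {P : ObjectProperty C} (hP : IsExtensionClosed P) :
    extensionClass (arrowClass P) = squareExtension (extensionClass P) := by
  ext X Y f
  constructor
  · rintro ⟨hf, hX, hK⟩
    obtain ⟨hk₁, hk₀⟩ := isKernelOf_arrow_components (isKernelOf_kernel_ι f)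
    obtain ⟨hf₁, hf₀⟩ := isRegularEpi_arrow_components hf
    have e₁ : extensionClass P f.left := hP.mk_extension hk₁ hf₁ hX.2.1 hK.2.1
    have e₀ : extensionClass P f.right :=
      hP.mk_extension hk₀ hf₀ (hP.target_mem hX) (hP.target_mem hK)
    have eY : extensionClass P Y.hom := hP.extension_of_comp e₁ (by
      rw [Arrow.w]; exact hP.extension_comp hX e₀)
    have hT := IsPullback.of_hasPullback Y.hom f.right
    refine ⟨e₁, e₀, hX, eY, _, _, _, hT, hP.extension_baseChange hT.flip e₀ (hP.target_mem e₁),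
      hP.extension_baseChange hT eY e₀.source, ?_⟩
    have hcp := hT.lift_fst f.left X.hom f.w
    have hcq := hT.lift_snd f.left X.hom f.w
    have hc := isRegularEpi_comparison hT hcp hcq hk₁ hk₀ (Arrow.w (kernel.ι f)).symm hf₁ hK.1
    obtain ⟨_, h, -, -⟩ := exists_isPullback_kernels hT hcp hcq hk₁ hk₀ (Arrow.w (kernel.ι f)).symm
    exact hP.mk_extension ((isKernelOf_kernel_ι _).map_isPullback h) hc hX.2.1 hK.2.2
  · rintro ⟨e₁, e₀, eX, eY, T, p, q, hT, hp, hq, hc⟩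
    obtain ⟨hk₁, hk₀⟩ := isKernelOf_arrow_components (isKernelOf_kernel_ι f)
    obtain ⟨_, h, -, -⟩ := exists_isPullback_kernels hT (hT.lift_fst f.left X.hom f.w)
      (hT.lift_snd f.left X.hom f.w) hk₁ hk₀ (Arrow.w (kernel.ι f)).symm
    exact ⟨isRegularEpi_arrow_of_components e₁.1 e₀.1, eX,
      hP.extension_baseChange h hc (hP.kernel_mem e₀ hk₀)⟩

end ExtensionClass

/-! ### Centralization -/

section Centralization

variable {C : Type u} [Category.{v} C] [HasZeroMorphisms C] [SemiAbelian C]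

/-- The properties of a centralization that are carried from `n` to `n + 1`. Here `P` is the class
of `n`-extensions. On `P`, the transformation `μ : J ⟶ 𝟭` is the kernel of the regular epimorphism
`η : 𝟭 ⟶ I`, the functor `J` preserves `n`-extensions and `(n+1)`-extensions, and `I` is
idempotent. -/
structure IsBirkhoffCentralization (P : ObjectProperty C) (D : Centralization C) : Prop where
  isKernelOf_μ {X : C} : P X → IsKernelOf (D.μ.app X) (D.η.app X)
  isRegularEpi_η {X : C} : P X → IsRegularEpi (D.η.app X)
  J_obj_mem {X : C} : P X → P (D.J.obj X)
  J_map_mem {X Y : C} {f : X ⟶ Y} : extensionClass P f → extensionClass P (D.J.map f)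
  isIso_η {X : C} : P X → IsIso (D.η.app (D.I.obj X))

namespace IsBirkhoffCentralization

variable {P : ObjectProperty C} {D : Centralization C}

lemma η_mem (hP : IsExtensionClosed P) (hD : IsBirkhoffCentralization P D) {X : C} (hX : P X) :
    extensionClass P (D.η.app X) :=
  hP.mk_extension (hD.isKernelOf_μ hX) (hD.isRegularEpi_η hX) hX (hD.J_obj_mem hX)

lemma I_obj_mem (hP : IsExtensionClosed P) (hD : IsBirkhoffCentralization P D) {X : C}
    (hX : P X) : P (D.I.obj X) :=
  hP.target_mem (hD.η_mem hP hX)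

lemma I_map_mem (hP : IsExtensionClosed P) (hD : IsBirkhoffCentralization P D) {X Y : C}
    {f : X ⟶ Y} (hf : extensionClass P f) : extensionClass P (D.I.map f) :=
  hP.extension_of_comp (hD.η_mem hP hf.source) (by
    have h : f ≫ D.η.app Y = D.η.app X ≫ D.I.map f := D.η.naturality f
    rw [← h]
    exact hP.extension_comp hf (hD.η_mem hP (hP.target_mem hf)))

lemma isIso_η_iff (hD : IsBirkhoffCentralization P D) {X : C} (hX : P X) :
    IsIso (D.η.app X) ↔ IsZero (D.J.obj X) := by
  have hk := hD.isKernelOf_μ hX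
  have hm := hk.mono
  constructor
  · intro h
    refine IsZero.of_mono_eq_zero (D.μ.app X) ?_
    rw [← cancel_mono (D.η.app X), hk.w, zero_comp]
  · exact fun h => isIso_of_isRegularEpi_of_mono (hD.isRegularEpi_η hX) (mono_of_isZero_kernel hk h)

/-- The naturality square of `η` at an extension `f`, seen as a morphism from `f` to `I f`, is an
extension of extensions, as its kernel is `J f`. -/
lemma naturality_mem (hP : IsExtensionClosed P) (hD : IsBirkhoffCentralization P D) {X Y : C}
    {f : X ⟶ Y} (hf : extensionClass P f) :
    squareExtension (extensionClass P) (Arrow.homMk (D.η.app X) (D.η.app Y)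
      (D.η.naturality f).symm : Arrow.mk f ⟶ Arrow.mk (D.I.map f)) := by
  have hY := hP.target_mem hf
  rw [← extensionClass_arrowClass hP]
  refine hP.arrowClass.mk_extension (K := Arrow.mk (D.J.map f))
    (k := (Arrow.homMk (D.μ.app X) (D.μ.app Y) (D.μ.naturality f).symm :
      Arrow.mk (D.J.map f) ⟶ Arrow.mk f)) ?_ ?_ hf (hD.J_map_mem hf)
  · exact isKernelOf_arrow_of_components (hD.isKernelOf_μ hf.source) (hD.isKernelOf_μ hY)
  · exact isRegularEpi_arrow_of_components (hD.isRegularEpi_η hf.source) (hD.isRegularEpi_η hY)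

lemma isPullback_naturality_iff (hP : IsExtensionClosed P) (hD : IsBirkhoffCentralization P D)
    {X Y : C} {f : X ⟶ Y} (hf : extensionClass P f) :
    IsPullback (D.η.app X) f (D.I.map f) (D.η.app Y) ↔ IsIso (D.J.map f) := by
  have hX := hD.isKernelOf_μ hf.source
  have hY := hD.isKernelOf_μ (hP.target_mem hf)
  have hη : f ≫ D.η.app Y = D.η.app X ≫ D.I.map f := D.η.naturality f
  have hμ : D.J.map f ≫ D.μ.app Y = D.μ.app X ≫ f := D.μ.naturality f
  constructor
  · intro h
    obtain ⟨k, hk, -, hk'⟩ := hY.exists_of_isPullback h.flip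
    obtain ⟨e, he⟩ := hX.exists_iso hk'
    have := hY.mono
    have : D.J.map f = e.hom := by
      rw [← cancel_mono (D.μ.app Y), hμ, ← he, Category.assoc, hk]
    rw [this]
    infer_instance
  · intro h
    have hT := IsPullback.of_hasPullback (D.I.map f) (D.η.app Y)
    obtain ⟨k, hk₁, hk₂, hk⟩ := hY.exists_of_isPullback hT.flip
    have : IsIso (hT.lift (D.η.app X) f hη.symm) := isIso_of_isKernelOf
      (hD.isRegularEpi_η hf.source)
      (isRegularEpi_of_isPullback hT.flip (hD.isRegularEpi_η (hP.target_mem hf)))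
      hX hk (D.J.map f) _ (𝟙 _) (by
        apply hT.hom_ext
        · rw [Category.assoc, hk₂, comp_zero, Category.assoc, hT.lift_fst, hX.w]
        · rw [Category.assoc, hk₁, Category.assoc, hT.lift_snd, hμ])
      (by rw [hT.lift_fst, Category.comp_id])
    exact IsPullback.of_iso_pullback ⟨hη.symm⟩ (asIso (hT.lift (D.η.app X) f hη.symm))
      (hT.lift_fst _ _ _) (hT.lift_snd _ _ _)

lemma isTrivialExtension_iff (hP : IsExtensionClosed P) (hD : IsBirkhoffCentralization P D)
    {X Y : C} {f : X ⟶ Y} (hf : extensionClass P f) :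
    IsTrivialExtension (extensionClass P) D.η f ↔ IsIso (D.J.map f) :=
  ⟨fun h => (hD.isPullback_naturality_iff hP hf).1 h.2,
    fun h => ⟨hf, (hD.isPullback_naturality_iff hP hf).2 h⟩⟩

/-- Given a pullback `T` of the unit at `X` and an extension `x : Y ⟶ I X`, the projection `T ⟶ Y`
is the unit at `T` up to isomorphism. -/
lemma isIso_of_isPullback_unit (hP : IsExtensionClosed P) (hD : IsBirkhoffCentralization P D)
    {T X Y : C} {p : T ⟶ X} {q : T ⟶ Y} {x : Y ⟶ D.I.obj X} (h : IsPullback p q (D.η.app X) x)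
    (hX : P X) (hx : extensionClass P x) (t : D.I.obj T ⟶ Y) (ht : D.η.app T ≫ t = q) :
    IsIso t := by
  have hp : extensionClass P p := hP.extension_baseChange h.flip hx hX
  have hq : extensionClass P q := hP.extension_baseChange h (hD.η_mem hP hX) hx.source
  have hXμ := hD.isKernelOf_μ hX
  have hTμ := hD.isKernelOf_μ hp.source
  have hXm := hXμ.mono
  obtain ⟨k, hkp, hkq, hk⟩ := hXμ.exists_of_isPullback h
  -- The kernel of the unit at `T` is contained in that of `q`; the inclusion is `J p`, which is a
  -- regular epimorphism. Hence `q` and the unit at `T` are cokernels of the same morphism.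
  obtain ⟨u, hu⟩ := hk.exists_lift (D.μ.app T) (by
    rw [← ht, ← Category.assoc]
    exact (congrArg (· ≫ t) hTμ.w).trans zero_comp)
  have hμ := D.μ.naturality p
  simp only [Functor.id_map] at hμ
  have hup : u = D.J.map p := by
    rw [← cancel_mono (D.μ.app X), hμ, ← hkp, ← Category.assoc, hu]
  have hu' : IsRegularEpi u := hup ▸ (hD.J_map_mem hp).1
  have hkη : k ≫ D.η.app T = 0 := by
    rw [← cancel_epi u, ← Category.assoc, hu, comp_zero]
    exact hTμ.w
  obtain ⟨l, hl⟩ := exists_desc_of_isKernelOf hq.1 hk _ hkη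
  have := hq.1
  have := hD.isRegularEpi_η hp.source
  refine ⟨l, ?_, ?_⟩
  · rw [← cancel_epi (D.η.app T), ← Category.assoc]
    exact (congrArg (· ≫ l) ht).trans (hl.trans (Category.comp_id _).symm)
  · rw [← cancel_epi q, ← Category.assoc, hl]
    exact ht.trans (Category.comp_id _).symm

end IsBirkhoffCentralization

/-! ### The kernel pair of an extension -/

section KernelPair

variable {P : ObjectProperty C}

lemma fst_mem (hP : IsExtensionClosed P) {f : Arrow C} (hf : arrowClass P f) :
    extensionClass P (pullback.fst f.hom f.hom) :=
  hP.extension_baseChange (IsPullback.of_hasPullback f.hom f.hom).flip hf hf.source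

/-- The transpose of a double extension is a double extension. -/
lemma transpose_mem (hP : IsExtensionClosed P) {f g : Arrow C} {φ : f ⟶ g}
    (hφ : extensionClass (arrowClass P) φ) :
    extensionClass (arrowClass P)
      (Arrow.homMk f.hom g.hom (Arrow.w φ).symm : Arrow.mk φ.left ⟶ Arrow.mk φ.right) := by
  rw [extensionClass_arrowClass hP] at hφ ⊢
  obtain ⟨h₁, h₂, h₃, h₄, T, p, q, hT, hp, hq, hc⟩ := hφ
  refine ⟨h₃, h₄, h₁, h₂, T, q, p, hT.flip, hq, hp, ?_⟩
  have : hT.flip.lift f.hom φ.left (Arrow.w φ).symm = hT.lift φ.left f.hom φ.w := by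
    apply hT.hom_ext
    · rw [hT.lift_fst, hT.flip.lift_snd]
    · rw [hT.lift_snd, hT.flip.lift_fst]
  exact this ▸ hc

lemma kernelPairMap_fst {f g : Arrow C} (φ : f ⟶ g) :
    Centralization.kernelPairMap φ ≫ pullback.fst g.hom g.hom =
      pullback.fst f.hom f.hom ≫ φ.left := by
  rw [Centralization.kernelPairMap, pullback.map, pullback.lift_fst]

lemma kernelPairMap_snd {f g : Arrow C} (φ : f ⟶ g) :
    Centralization.kernelPairMap φ ≫ pullback.snd g.hom g.hom =
      pullback.snd f.hom f.hom ≫ φ.left := by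
  rw [Centralization.kernelPairMap, pullback.map, pullback.lift_snd]

/-- A double extension induces an extension between kernel pairs, being the kernel pair of its
transpose in the category of arrows. -/
lemma kernelPairMap_mem (hP : IsExtensionClosed P) {f g : Arrow C} {φ : f ⟶ g}
    (hφ : extensionClass (arrowClass P) φ) :
    extensionClass P (Centralization.kernelPairMap φ) := by
  have hT := transpose_mem hP hφ
  have h : IsPullback
      (Arrow.homMk (pullback.fst f.hom f.hom) (pullback.fst g.hom g.hom)
        (kernelPairMap_fst φ).symm :
          Arrow.mk (Centralization.kernelPairMap φ) ⟶ Arrow.mk φ.left)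
      (Arrow.homMk (pullback.snd f.hom f.hom) (pullback.snd g.hom g.hom)
        (kernelPairMap_snd φ).symm :
          Arrow.mk (Centralization.kernelPairMap φ) ⟶ Arrow.mk φ.left)
      (Arrow.homMk f.hom g.hom (Arrow.w φ).symm : Arrow.mk φ.left ⟶ Arrow.mk φ.right)
      (Arrow.homMk f.hom g.hom (Arrow.w φ).symm : Arrow.mk φ.left ⟶ Arrow.mk φ.right) :=
    isPullback_arrow_of_components (IsPullback.of_hasPullback f.hom f.hom)
      (IsPullback.of_hasPullback g.hom g.hom)
  exact (hP.arrowClass.extension_baseChange h hT hT.source).source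

/-- The diagonal of the kernel pair. -/
def kernelPairDiagonal (f : Arrow C) : f.left ⟶ pullback f.hom f.hom :=
  pullback.lift (𝟙 _) (𝟙 _) rfl

lemma kernelPairDiagonal_fst (f : Arrow C) :
    kernelPairDiagonal f ≫ pullback.fst f.hom f.hom = 𝟙 _ := pullback.lift_fst _ _ _

lemma kernelPairDiagonal_map {f g : Arrow C} (φ : f ⟶ g) :
    kernelPairDiagonal f ≫ Centralization.kernelPairMap φ = φ.left ≫ kernelPairDiagonal g := by
  apply pullback.hom_ext
  · rw [Category.assoc, kernelPairMap_fst, Category.assoc, kernelPairDiagonal,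
      pullback.lift_fst_assoc, kernelPairDiagonal, pullback.lift_fst, Category.id_comp,
      Category.comp_id]
  · rw [Category.assoc, kernelPairMap_snd, Category.assoc, kernelPairDiagonal,
      pullback.lift_snd_assoc, kernelPairDiagonal, pullback.lift_snd, Category.id_comp,
      Category.comp_id]

end KernelPair

/-! ### Centralization one dimension up -/

/-- The embedding of `J₁[f]` in the kernel pair of `f`. -/
def Centralization.topEmbedding (D : Centralization C) (f : Arrow C) :
    D.top f ⟶ pullback f.hom f.hom :=
  kernel.ι (D.J.map (pullback.fst f.hom f.hom)) ≫ D.μ.app (pullback f.hom f.hom)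

namespace IsBirkhoffCentralization

variable {P : ObjectProperty C} {D : Centralization C}

lemma J_fst_mem (hP : IsExtensionClosed P) (hD : IsBirkhoffCentralization P D) {f : Arrow C}
    (hf : arrowClass P f) : extensionClass P (D.J.map (pullback.fst f.hom f.hom)) :=
  hD.J_map_mem (fst_mem hP hf)

lemma top_mem (hP : IsExtensionClosed P) (hD : IsBirkhoffCentralization P D) {f : Arrow C}
    (hf : arrowClass P f) : P (D.top f) :=
  (hD.J_fst_mem hP hf).2.2

/-- The functor `J` sends the kernel pairs of the domain and codomain of a double extension to a
split epimorphism of extensions, so that its kernel is an extension. -/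
lemma topMap_mem (hP : IsExtensionClosed P) (hD : IsBirkhoffCentralization P D) {f g : Arrow C}
    {φ : f ⟶ g} (hφ : extensionClass (arrowClass P) φ) : extensionClass P (D.topMap φ) := by
  have hφ' := hφ
  rw [extensionClass_arrowClass hP] at hφ'
  let ψ : Arrow.mk (D.J.map (Centralization.kernelPairMap φ)) ⟶ Arrow.mk (D.J.map φ.left) :=
    Arrow.homMk (D.J.map (pullback.fst f.hom f.hom)) (D.J.map (pullback.fst g.hom g.hom)) (by
      dsimp only [Arrow.mk_hom]
      rw [← D.J.map_comp, ← D.J.map_comp, kernelPairMap_fst])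
  let s : Arrow.mk (D.J.map φ.left) ⟶ Arrow.mk (D.J.map (Centralization.kernelPairMap φ)) :=
    Arrow.homMk (D.J.map (kernelPairDiagonal f)) (D.J.map (kernelPairDiagonal g)) (by
      dsimp only [Arrow.mk_hom]
      rw [← D.J.map_comp, ← D.J.map_comp, kernelPairDiagonal_map])
  have hs : s ≫ ψ = 𝟙 _ := by
    ext
    · exact (D.J.map_comp _ _).symm.trans (by rw [kernelPairDiagonal_fst, D.J.map_id]; rfl)
    · exact (D.J.map_comp _ _).symm.trans (by rw [kernelPairDiagonal_fst, D.J.map_id]; rfl)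
  have hk : IsKernelOf (Arrow.homMk (kernel.ι (D.J.map (pullback.fst f.hom f.hom)))
      (kernel.ι (D.J.map (pullback.fst g.hom g.hom))) (D.topMap_ι φ).symm :
      Arrow.mk (D.topMap φ) ⟶ Arrow.mk (D.J.map (Centralization.kernelPairMap φ))) ψ :=
    isKernelOf_arrow_of_components (isKernelOf_kernel_ι _) (isKernelOf_kernel_ι _)
  exact hP.arrowClass.of_split hk hs (hD.J_map_mem (kernelPairMap_mem hP hφ))
    (hD.J_map_mem hφ'.1)

lemma topEmbedding_fst (D : Centralization C) (f : Arrow C) :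
    D.topEmbedding f ≫ pullback.fst f.hom f.hom = 0 := by
  have h := D.μ.naturality (pullback.fst f.hom f.hom)
  simp only [Functor.id_map] at h
  rw [Centralization.topEmbedding, Category.assoc, ← h, kernel.condition_assoc, zero_comp]

lemma topEmbedding_snd (D : Centralization C) (f : Arrow C) :
    D.topEmbedding f ≫ pullback.snd f.hom f.hom = D.topι f := by
  have h := D.μ.naturality (pullback.snd f.hom f.hom)
  simp only [Functor.id_map] at h
  rw [Centralization.topEmbedding, Category.assoc, ← h, Centralization.topι]

/-- `J₁[f]`, embedded in the kernel pair `R[f]`, is the intersection of the kernels of the first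
projection and of the unit at `R[f]`. -/
lemma isKernelOf_topEmbedding (hP : IsExtensionClosed P) (hD : IsBirkhoffCentralization P D)
    {f : Arrow C} (hf : arrowClass P f) : IsKernelOf (D.topEmbedding f)
      (prod.lift (pullback.fst f.hom f.hom) (D.η.app (pullback f.hom f.hom))) := by
  have hR := hD.isKernelOf_μ (fst_mem hP hf).source
  have hB := (hD.isKernelOf_μ hf.source).mono
  have := hR.mono
  have hμ := D.μ.naturality (pullback.fst f.hom f.hom)
  simp only [Functor.id_map] at hμ
  refine ⟨by rw [Centralization.topEmbedding]; exact mono_comp _ _, ?_, fun t ht => ?_⟩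
  · apply prod.hom_ext
    · rw [Category.assoc, prod.lift_fst, topEmbedding_fst, zero_comp]
    · rw [Category.assoc, prod.lift_snd, Centralization.topEmbedding, Category.assoc, hR.w,
        comp_zero, zero_comp]
  · have h₁ : t ≫ pullback.fst f.hom f.hom = 0 := by
      simpa only [Category.assoc, prod.lift_fst, zero_comp] using congrArg (· ≫ prod.fst) ht
    have h₂ : t ≫ D.η.app (pullback f.hom f.hom) = 0 := by
      simpa only [Category.assoc, prod.lift_snd, zero_comp] using congrArg (· ≫ prod.snd) ht
    obtain ⟨l, hl⟩ := hR.exists_lift t h₂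
    have hl' : l ≫ D.J.map (pullback.fst f.hom f.hom) = 0 := by
      rw [← cancel_mono (D.μ.app f.left), Category.assoc, hμ, ← Category.assoc, zero_comp]
      exact (congrArg (· ≫ pullback.fst f.hom f.hom) hl).trans h₁
    refine ⟨kernel.lift _ l hl', ?_⟩
    rw [Centralization.topEmbedding, kernel.lift_ι_assoc]
    exact hl

/-- `J₁[f] ⟶ B` is a normal monomorphism, being the regular image of a normal monomorphism under
the second projection of the kernel pair. -/
lemma isKernelOf_topι (hP : IsExtensionClosed P) (hD : IsBirkhoffCentralization P D) {f : Arrow C}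
    (hf : arrowClass P f) : IsKernelOf (D.topι f) (cokernel.π (D.topι f)) := by
  have hk := hD.isKernelOf_topEmbedding hP hf
  have hmk := hk.mono
  have hmono : Mono (D.topι f) := ⟨fun a b hab => by
    rw [← topEmbedding_snd] at hab
    rw [← cancel_mono (D.topEmbedding f)]
    apply pullback.hom_ext
    · rw [Category.assoc, Category.assoc, topEmbedding_fst, comp_zero, comp_zero]
    · rw [Category.assoc, Category.assoc, hab]⟩
  have hq : IsRegularEpi (pullback.snd f.hom f.hom) :=
    isRegularEpi_of_isPullback (IsPullback.of_hasPullback f.hom f.hom) hf.1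
  exact isKernelOf_cokernel_of_image hk hq (topEmbedding_snd D f)

lemma next_isKernelOf_μ (hP : IsExtensionClosed P) (hD : IsBirkhoffCentralization P D)
    {f : Arrow C} (hf : arrowClass P f) : IsKernelOf (D.next.μ.app f) (D.next.η.app f) := by
  refine isKernelOf_arrow_of_components (hD.isKernelOf_topι hP hf) ?_
  exact isKernelOf_zero_of_mono (isZero_zero C) (𝟙 f.right)

lemma next_isRegularEpi_η (f : Arrow C) : IsRegularEpi (D.next.η.app f) :=
  isRegularEpi_arrow_of_components (isRegularEpi_cokernel_π _)
    (inferInstanceAs (IsRegularEpi (𝟙 f.right)))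

/-- An extension is fixed by the reflection one dimension up when `J₁[f]` is zero. -/
lemma next_isIso_η_iff (hP : IsExtensionClosed P) (hD : IsBirkhoffCentralization P D)
    {f : Arrow C} (hf : arrowClass P f) : IsIso (D.next.η.app f) ↔ IsZero (D.top f) := by
  have hk := hD.isKernelOf_topι hP hf
  have hm := hk.mono
  constructor
  · intro h
    have : IsIso (cokernel.π (D.topι f)) := inferInstanceAs (IsIso (D.next.η.app f).left)
    refine IsZero.of_mono_eq_zero (D.topι f) ?_
    rw [← cancel_mono (cokernel.π (D.topι f)), hk.w, zero_comp]
  · intro h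
    have : IsIso (D.next.η.app f).left := isIso_of_isRegularEpi_of_mono
      (isRegularEpi_cokernel_π (D.topι f)) (mono_of_isZero_kernel hk h)
    have : IsIso (D.next.η.app f).right := inferInstanceAs (IsIso (𝟙 f.right))
    exact Arrow.isIso_of_isIso_left_of_isIso_right _

lemma isZero_top_of_extension (hP : IsExtensionClosed P) (hD : IsBirkhoffCentralization P D)
    {f g : Arrow C} {φ : f ⟶ g} (hφ : extensionClass (arrowClass P) φ)
    (h : D.topι f ≫ φ.left = 0) : IsZero (D.top g) := by
  have hm := (hD.isKernelOf_topι hP (hP.arrowClass.target_mem hφ)).mono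
  have := (hD.topMap_mem hP hφ).isRegularEpi
  refine isZero_of_epi_zero (D.topMap φ) ?_
  rw [← cancel_mono (D.topι g), D.topMap_topι, h, zero_comp]

open ZeroObject in
lemma zero_mem_arrowClass (hP : IsExtensionClosed P) {X : C} (hX : P X) :
    arrowClass P (Arrow.mk (0 : X ⟶ (0 : C))) :=
  hP.extension_of_split (s := 0) ((isZero_zero C).eq_of_src _ _) hX (hP.of_isZero (isZero_zero C))

/-- The centralization one dimension up inherits the properties of the given one. -/
lemma next (hP : IsExtensionClosed P) (hD : IsBirkhoffCentralization P D) :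
    IsBirkhoffCentralization (arrowClass P) D.next where
  isKernelOf_μ hf := hD.next_isKernelOf_μ hP hf
  isRegularEpi_η _ := next_isRegularEpi_η _
  J_obj_mem hf := zero_mem_arrowClass hP (hD.top_mem hP hf)
  J_map_mem {f g φ} hφ := by
    have h := hD.topMap_mem hP hφ
    have hk := isKernelOf_kernel_ι (D.topMap φ)
    open ZeroObject in
    let κ : Arrow.mk (0 : kernel (D.topMap φ) ⟶ (0 : C)) ⟶ D.next.J.obj f :=
      Arrow.homMk (kernel.ι (D.topMap φ)) (𝟙 (0 : C)) ((isZero_zero C).eq_of_tgt _ _)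
    refine hP.arrowClass.mk_extension (k := κ) ?_ ?_
      (zero_mem_arrowClass hP (hD.top_mem hP hφ.source)) (zero_mem_arrowClass hP h.2.2)
    · refine isKernelOf_arrow_of_components hk ?_
      have : Mono (D.next.J.map φ).right := ⟨fun _ _ _ => (isZero_zero C).eq_of_tgt _ _⟩
      have h := isKernelOf_zero_of_mono (isZero_zero C) (D.next.J.map φ).right
      have e : κ.right = 0 := (isZero_zero C).eq_of_tgt _ _
      rw [e]
      exact h
    · exact isRegularEpi_arrow_of_components h.1 (inferInstanceAs (IsRegularEpi (𝟙 (0 : C))))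
  isIso_η {f} hf := by
    have hη : extensionClass (arrowClass P) (D.next.η.app f) :=
      hP.arrowClass.mk_extension (hD.next_isKernelOf_μ hP hf) (next_isRegularEpi_η f) hf
        (zero_mem_arrowClass hP (hD.top_mem hP hf))
    exact (hD.next_isIso_η_iff hP (hP.arrowClass.target_mem hη)).2
      (hD.isZero_top_of_extension hP hη (cokernel.condition _))

/-! ### Central and normal extensions -/

/-- An extension is normal exactly when `J` inverts the first projection of its kernel pair, that
is, when the kernel `J₁[f]` of this split epimorphism vanishes. -/
lemma isNormalExtension_iff (hP : IsExtensionClosed P) (hD : IsBirkhoffCentralization P D)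
    {X Y : C} {f : X ⟶ Y} (hf : extensionClass P f) :
    IsNormalExtension (extensionClass P) D.η f ↔ IsZero (D.top (Arrow.mk f)) := by
  have hfst : extensionClass P (pullback.fst f f) := fst_mem hP (f := Arrow.mk f) hf
  have hk := isKernelOf_kernel_ι (D.J.map (pullback.fst f f))
  constructor
  · rintro ⟨-, R, π₁, π₂, hR, hπ⟩
    have h := (hD.isTrivialExtension_iff hP hπ.1).1 hπ
    let e := hR.isoPullback
    have he : pullback.fst f f = e.inv ≫ π₁ := hR.isoPullback_inv_fst.symm
    have : IsIso (D.J.map (pullback.fst f f)) := by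
      rw [he, D.J.map_comp]
      infer_instance
    refine IsZero.of_mono_eq_zero (kernel.ι (D.J.map (pullback.fst f f))) ?_
    rw [← cancel_mono (D.J.map (pullback.fst f f)), hk.w, zero_comp]
  · intro h
    refine ⟨hf, _, _, _, IsKernelPair.of_hasPullback f, ?_⟩
    exact (hD.isTrivialExtension_iff hP hfst).2 (isIso_of_isRegularEpi_of_mono
      (hD.J_map_mem hfst).1 (mono_of_isZero_kernel hk h))

/-- If `J f` is invertible, `J` identifies the two projections of the kernel pair. -/
lemma isZero_top_of_isTrivialExtension (hP : IsExtensionClosed P)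
    (hD : IsBirkhoffCentralization P D) {X Y : C} {f : X ⟶ Y}
    (hf : IsTrivialExtension (extensionClass P) D.η f) : IsZero (D.top (Arrow.mk f)) := by
  have := (hD.isTrivialExtension_iff hP hf.1).1 hf
  have hm := (hD.isKernelOf_topι hP (f := Arrow.mk f) hf.1).mono
  have h : D.J.map (pullback.snd f f) = D.J.map (pullback.fst f f) := by
    rw [← cancel_mono (D.J.map f), ← D.J.map_comp, ← D.J.map_comp, pullback.condition]
  refine IsZero.of_mono_eq_zero (D.topι (Arrow.mk f)) ?_
  change kernel.ι (D.J.map (pullback.fst f f)) ≫ D.J.map (pullback.snd f f) ≫ D.μ.app X = 0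
  rw [h, kernel.condition_assoc, zero_comp]

/-- A pullback of an extension along an extension is a double extension. -/
lemma squareExtension_of_isPullback (hP : IsExtensionClosed P) {X Y X₀ Y₀ : C} {a : Y₀ ⟶ Y}
    {a' : X₀ ⟶ X} {f₀ : X₀ ⟶ Y₀} {f : X ⟶ Y} (h : IsPullback a' f₀ f a)
    (hf : extensionClass P f) (ha : extensionClass P a) :
    squareExtension (extensionClass P) (Arrow.homMk a' a h.w : Arrow.mk f₀ ⟶ Arrow.mk f) := by
  have hf₀ := hP.extension_baseChange h hf ha.source
  have ha' := hP.extension_baseChange h.flip ha hf.source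
  refine ⟨ha', ha, hf₀, hf, X₀, a', f₀, h, ha', hf₀, ?_⟩
  have : h.lift a' f₀ h.w = 𝟙 X₀ := by
    apply h.hom_ext
    · rw [h.lift_fst, Category.id_comp]
    · rw [h.lift_snd, Category.id_comp]
  exact this ▸ hP.extension_of_isIso (𝟙 X₀) hf₀.source

lemma isZero_top_of_isCentralExtension (hP : IsExtensionClosed P)
    (hD : IsBirkhoffCentralization P D) {X Y : C} {f : X ⟶ Y}
    (hf : IsCentralExtension (extensionClass P) D.η f) : IsZero (D.top (Arrow.mk f)) := by
  obtain ⟨hf, X₀, Y₀, a, a', f₀, ha, h, h₀⟩ := hf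
  have hφ := squareExtension_of_isPullback hP h hf ha
  rw [← extensionClass_arrowClass hP] at hφ
  exact hD.isZero_top_of_extension hP hφ
    ((hD.isZero_top_of_isTrivialExtension hP h₀).eq_of_src _ _)

lemma isCentralExtension_iff (hP : IsExtensionClosed P) (hD : IsBirkhoffCentralization P D)
    {X Y : C} {f : X ⟶ Y} (hf : extensionClass P f) :
    IsCentralExtension (extensionClass P) D.η f ↔ IsZero (D.top (Arrow.mk f)) := by
  refine ⟨hD.isZero_top_of_isCentralExtension hP, fun h => ?_⟩
  obtain ⟨-, R, π₁, π₂, hR, hπ⟩ := (hD.isNormalExtension_iff hP hf).2 h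
  exact ⟨hf, R, X, f, π₂, π₁, hf, hR.flip, hπ⟩

end IsBirkhoffCentralization

end Centralization

/-! ### The Galois structure of a level of the tower -/

namespace Centralization

variable {C : Type w} [Category.{v} C] (D : Centralization C)

lemma unit_map_comp_inv {X Y : C} [IsIso (D.η.app Y)] (f : X ⟶ Y) :
    D.η.app X ≫ D.I.map f ≫ inv (D.η.app Y) = f := by
  have h := D.η.naturality f
  simp only [Functor.id_map] at h
  rw [← Category.assoc, IsIso.comp_inv_eq]
  exact h.symm

lemma map_unit_comp_inv {X Y : C} [IsIso (D.η.app Y)] [Epi (D.η.app X)] (g : D.I.obj X ⟶ Y) :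
    D.I.map (D.η.app X ≫ g : X ⟶ Y) ≫ inv (D.η.app Y) = g := by
  rw [← cancel_epi (D.η.app X)]
  exact D.unit_map_comp_inv (D.η.app X ≫ g : X ⟶ Y)

end Centralization

namespace Level

/-- The inductive invariant of the tower: the class `E` is determined by the class of extensions,
which has the required closure properties, the centralization has the Birkhoff properties, and the
central extensions are the extensions fixed by the reflection. -/
structure IsBirkhoff (S : Level.{v, w}) [SemiAbelian S.C] : Prop where
  E_eq : S.E = extensionClass S.ext
  closed : IsExtensionClosed S.ext
  birkhoff : IsBirkhoffCentralization S.ext S.cen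
  cext_iff {X : S.C} : S.ext X → (S.cext X ↔ IsIso (S.cen.η.app X))

namespace IsBirkhoff

variable {S : Level.{v, w}} [SemiAbelian S.C]

/-- The invariant passes to the next level, if the central extensions there are the normal ones. -/
lemma next (h : S.IsBirkhoff) {K : ObjectProperty (Arrow S.C)}
    (hK : ∀ f : Arrow S.C, S.E f.hom → (K f ↔ IsZero (S.cen.top f))) :
    have : SemiAbelian (S.next K).C := arrowSemiAbelian (C := S.C)
    (S.next K).IsBirkhoff := by
  let : SemiAbelian (S.next K).C := arrowSemiAbelian (C := S.C)
  have hext : (S.next K).ext = arrowClass S.ext := by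
    change (fun f : Arrow S.C => S.E f.hom) = _
    rw [h.E_eq]
    rfl
  refine ⟨?_, ?_, ?_, ?_⟩
  · rw [hext]
    refine Eq.trans ?_ (extensionClass_arrowClass h.closed).symm
    rw [← h.E_eq]
    rfl
  · rw [hext]
    exact h.closed.arrowClass
  · rw [hext]
    exact h.birkhoff.next h.closed
  · intro f hf
    have hf' : arrowClass S.ext f := hext ▸ hf
    exact (hK f hf).trans (h.birkhoff.next_isIso_η_iff h.closed hf').symm

lemma E_iff (h : S.IsBirkhoff) {X Y : S.C} (f : X ⟶ Y) : S.E f ↔ extensionClass S.ext f := by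
  rw [h.E_eq]

lemma extE_iff (h : S.IsBirkhoff) {X Y : S.Ext} (f : X ⟶ Y) :
    S.extE f ↔ extensionClass S.ext f.hom :=
  h.E_iff f.hom

lemma ext_I_obj (h : S.IsBirkhoff) (X : S.Ext) : S.ext (S.cen.I.obj X.obj) :=
  h.birkhoff.I_obj_mem h.closed X.property

lemma cext_I_obj (h : S.IsBirkhoff) (X : S.Ext) : S.cext (S.cen.I.obj X.obj) :=
  (h.cext_iff (h.ext_I_obj X)).2 (h.birkhoff.isIso_η X.property)

lemma isIso_η (h : S.IsBirkhoff) (Y : S.CExt) : IsIso (S.cen.η.app Y.obj.obj) :=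
  (h.cext_iff Y.obj.property).1 Y.property

/-- The reflector, as a functor from extensions to central extensions. -/
abbrev refl (h : S.IsBirkhoff) : S.Ext ⥤ S.CExt := S.reflector h.ext_I_obj h.cext_I_obj

/-- The adjunction between the reflector and the inclusion of central extensions, with unit `η`. -/
def adjunction (h : S.IsBirkhoff) : h.refl ⊣ S.central.ι :=
  Adjunction.mkOfHomEquiv
    { homEquiv := fun X Y =>
        { toFun := fun g => ObjectProperty.homMk (S.cen.η.app X.obj ≫ g.hom.hom)
          invFun := fun f => ObjectProperty.homMk (ObjectProperty.homMk
            (S.cen.I.map f.hom ≫ @inv _ _ _ _ (S.cen.η.app Y.obj.obj) (h.isIso_η Y)))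
          left_inv := fun g => by
            have := h.isIso_η Y
            have := h.birkhoff.isRegularEpi_η X.property
            ext
            exact S.cen.map_unit_comp_inv (X := X.obj) (Y := Y.obj.obj) g.hom.hom
          right_inv := fun f => by
            have := h.isIso_η Y
            ext
            exact S.cen.unit_map_comp_inv (X := X.obj) (Y := Y.obj.obj) f.hom }
      homEquiv_naturality_left_symm := fun f g => by
        ext
        exact (congrArg (· ≫ _) (S.cen.I.map_comp f.hom g.hom)).trans (Category.assoc _ _ _)
      homEquiv_naturality_right := fun f g => by
        ext
        exact (Category.assoc _ _ _).symm }

lemma adjunction_unit (h : S.IsBirkhoff) (X : S.Ext) :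
    (h.adjunction.unit.app X).hom = S.cen.η.app X.obj :=
  Category.comp_id _

/-! ### Pullbacks of extensions -/

omit [SemiAbelian S.C] in
lemma isPullback_of_hom {T X Y W : S.Ext} {p : T ⟶ X} {q : T ⟶ W} {f : X ⟶ Y} {g : W ⟶ Y}
    (h : IsPullback p.hom q.hom f.hom g.hom) : IsPullback p q f g :=
  IsPullback.of_map S.ext.ι (by ext; exact h.w) h

/-- The pullback of an extension in the ambient category, as a pullback of extensions. -/
lemma exists_isPullback (h : S.IsBirkhoff) {X Y W : S.Ext} {f : X ⟶ Y} (g : W ⟶ Y)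
    (hf : S.extE f) : ∃ (T : S.Ext) (p : T ⟶ X) (q : T ⟶ W),
      IsPullback p q f g ∧ IsPullback p.hom q.hom f.hom g.hom := by
  have hT := IsPullback.of_hasPullback f.hom g.hom
  have hq := h.closed.extension_baseChange hT ((h.extE_iff f).1 hf) W.property
  exact ⟨⟨_, hq.source⟩, ObjectProperty.homMk (pullback.fst f.hom g.hom),
    ObjectProperty.homMk (pullback.snd f.hom g.hom), isPullback_of_hom hT, hT⟩

lemma isPullback_hom (h : S.IsBirkhoff) {T X Y W : S.Ext} {p : T ⟶ X} {q : T ⟶ W} {f : X ⟶ Y}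
    {g : W ⟶ Y} (hT : IsPullback p q f g) (hf : S.extE f) :
    IsPullback p.hom q.hom f.hom g.hom := by
  obtain ⟨T', p', q', h₁, h₂⟩ := h.exists_isPullback g hf
  exact IsPullback.of_iso h₂ (S.ext.ι.mapIso (h₁.isoIsPullback _ _ hT)) (Iso.refl _) (Iso.refl _)
    (Iso.refl _)
    ((Category.comp_id _).trans (congrArg InducedCategory.Hom.hom
      (h₁.isoIsPullback_hom_fst _ _ hT)).symm)
    ((Category.comp_id _).trans (congrArg InducedCategory.Hom.hom
      (h₁.isoIsPullback_hom_snd _ _ hT)).symm)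
    ((Category.comp_id _).trans (Category.id_comp _).symm)
    ((Category.comp_id _).trans (Category.id_comp _).symm)

lemma extE_baseChange (h : S.IsBirkhoff) : S.extE.IsStableUnderBaseChange :=
  ⟨fun {W _ _ _ _ _ _ _} hT hf => (h.extE_iff _).2 (h.closed.extension_baseChange
    (h.isPullback_hom hT hf) ((h.extE_iff _).1 hf) W.property)⟩

lemma extE_comp (h : S.IsBirkhoff) : S.extE.IsStableUnderComposition :=
  ⟨fun f g hf hg => (h.extE_iff _).2
    (h.closed.extension_comp ((h.extE_iff f).1 hf) ((h.extE_iff g).1 hg))⟩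

lemma extE_of_isIso (h : S.IsBirkhoff) {X Y : S.Ext} (f : X ⟶ Y) [IsIso f] : S.extE f :=
  (h.extE_iff f).2 (h.closed.extension_of_isIso f.hom X.property)

lemma unit_mem (h : S.IsBirkhoff) (X : S.Ext) : S.extE (h.adjunction.unit.app X) := by
  rw [h.extE_iff, h.adjunction_unit]
  exact h.birkhoff.η_mem h.closed X.property

lemma refl_map_mem (h : S.IsBirkhoff) {X Y : S.Ext} {f : X ⟶ Y} (hf : S.extE f) :
    S.extE (S.central.ι.map (h.refl.map f)) :=
  (h.extE_iff _).2 (h.birkhoff.I_map_mem h.closed ((h.extE_iff f).1 hf))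

/-! ### The Galois structure -/

lemma isGaloisStructure (h : S.IsBirkhoff) : IsGaloisStructure S.extE S.cextZ h.adjunction where
  hasPullback f g hf := by
    obtain ⟨T, p, q, hT, -⟩ := h.exists_isPullback g hf
    exact hT.hasPullback
  isomorphisms_le_left _ _ f hf := by
    have : IsIso f := hf
    exact h.extE_of_isIso f
  comp_left := h.extE_comp
  baseChange_left := h.extE_baseChange
  isomorphisms_le_right _ _ f hf := by
    have : IsIso f := hf
    exact h.extE_of_isIso (S.central.ι.map f)
  comp_right := ⟨fun f g hf hg => h.extE_comp.comp_mem f.hom g.hom hf hg⟩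
  baseChange_right := ⟨fun {_ _ _ _ _ _ _ _} hT hf => by
    -- The inclusion preserves limits, being a right adjoint.
    have := h.adjunction.rightAdjoint_preservesLimits
    exact h.extE_baseChange.of_isPullback (hT.map S.central.ι) hf⟩
  map_reflector _ hf := h.refl_map_mem hf
  map_inclusion _ hf := hf
  isIso_counit := inferInstance
  unit_mem := h.unit_mem

lemma isAdmissible (h : S.IsBirkhoff) : IsAdmissible S.cextZ h.adjunction := by
  intro X Y x hx P p q hP
  have ht : h.adjunction.unit.app P ≫ S.central.ι.map ((h.adjunction.homEquiv P Y).symm q) = q :=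
    (h.adjunction.homEquiv_unit _ _ _).symm.trans (Equiv.apply_symm_apply _ _)
  generalize (h.adjunction.homEquiv P Y).symm q = t at ht ⊢
  have hP' := h.isPullback_hom hP (h.unit_mem X)
  rw [h.adjunction_unit] at hP'
  have ht' : S.cen.η.app P.obj ≫ t.hom.hom = q.hom := by
    rw [← ht, ← h.adjunction_unit]
    rfl
  have : IsIso t.hom.hom := h.birkhoff.isIso_of_isPullback_unit h.closed hP' X.property
    ((h.extE_iff (S.central.ι.map x)).1 hx) t.hom.hom ht'
  have : IsIso t.hom := (ObjectProperty.isIso_hom_iff t.hom).1 this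
  exact (ObjectProperty.isIso_hom_iff t).1 this

lemma extE_le_regularEpi (h : S.IsBirkhoff) : S.extE ≤ MorphismProperty.regularEpi S.Ext := by
  intro X Y f hf
  obtain ⟨R, p, q, hR, hRC⟩ := h.exists_isPullback f hf
  have hreg := ((h.extE_iff f).1 hf).1
  have hd (s : Cofork p q) : ∃ t : Y ⟶ s.pt, f ≫ t = s.π := by
    obtain ⟨t, ht⟩ := IsRegularEpi.exists_of_isKernelPair f.hom hRC s.π.hom
      (congrArg InducedCategory.Hom.hom s.condition)
    exact ⟨ObjectProperty.homMk t, by ext; exact ht⟩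
  have : Epi f := S.ext.ι.epi_of_epi_map (inferInstanceAs (Epi f.hom))
  exact ⟨⟨{ W := R, left := p, right := q, w := hR.w,
            isColimit := Cofork.IsColimit.mk _ (fun s => (hd s).choose)
              (fun s => (hd s).choose_spec) (fun s m hm => by
                rw [← cancel_epi f]
                exact hm.trans (hd s).choose_spec.symm) }⟩⟩

lemma isStronglyBirkhoff (h : S.IsBirkhoff) : IsStronglyBirkhoff S.extE h.adjunction where
  le_regularEpi := h.extE_le_regularEpi
  baseChange := h.extE_baseChange
  full := inferInstance
  faithful := inferInstance
  replete Y X e := by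
    refine ⟨⟨X, (h.cext_iff X.property).2 ?_⟩, rfl⟩
    have hY := (h.birkhoff.isIso_η_iff Y.obj.property).1 (h.isIso_η Y)
    exact (h.birkhoff.isIso_η_iff X.property).2
      (hY.of_iso (S.cen.J.mapIso (S.ext.ι.mapIso e.symm)))
  unit_mem := h.unit_mem
  map_mem _ hf := h.refl_map_mem hf
  comparison_mem {X Y} f hf := by
    obtain ⟨-, -, -, -, T, p, q, hT, hp, hq, hc⟩ :=
      h.birkhoff.naturality_mem h.closed ((h.extE_iff f).1 hf)
    let T' : S.Ext := ⟨T, hp.source⟩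
    let p' : T' ⟶ S.central.ι.obj (h.refl.obj X) := ObjectProperty.homMk p
    let q' : T' ⟶ Y := ObjectProperty.homMk q
    have hT' : IsPullback q' p' (h.adjunction.unit.app Y) (S.central.ι.map (h.refl.map f)) := by
      refine isPullback_of_hom ?_
      rw [h.adjunction_unit]
      exact hT.flip
    refine ⟨T', q', p', hT', (h.extE_iff _).2 hq, (h.extE_iff _).2 hp, (h.extE_iff _).2 ?_⟩
    have e : (hT'.lift f (h.adjunction.unit.app X) (h.adjunction.unit.naturality f)).hom =
        hT.lift (S.cen.η.app X.obj) f.hom (S.cen.η.naturality f.hom).symm := by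
      apply hT.hom_ext
      · exact ((congrArg InducedCategory.Hom.hom (hT'.lift_snd _ _ _)).trans
          (h.adjunction_unit X)).trans (hT.lift_fst _ _ _).symm
      · exact (congrArg InducedCategory.Hom.hom (hT'.lift_fst _ _ _)).trans
          (hT.lift_snd _ _ _).symm
    rw [e]
    exact hc

/-! ### Central and normal extensions among extensions -/

lemma isTrivialExtension_iff (h : S.IsBirkhoff) {X Y : S.Ext} (f : X ⟶ Y) :
    IsTrivialExtension S.extE h.adjunction.unit f ↔
      IsTrivialExtension (extensionClass S.ext) S.cen.η f.hom := by
  have key (hf : S.extE f) : IsPullback (h.adjunction.unit.app X) f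
      ((h.refl ⋙ S.central.ι).map f) (h.adjunction.unit.app Y) ↔
        IsPullback (S.cen.η.app X.obj) f.hom (S.cen.I.map f.hom) (S.cen.η.app Y.obj) := by
    constructor
    · intro hT
      have h' := h.isPullback_hom hT (h.refl_map_mem hf)
      rwa [h.adjunction_unit, h.adjunction_unit] at h'
    · intro hT
      refine isPullback_of_hom ?_
      rw [h.adjunction_unit, h.adjunction_unit]
      exact hT
  exact ⟨fun ⟨hf, hT⟩ => ⟨(h.extE_iff f).1 hf, (key hf).1 hT⟩,
    fun ⟨hf, hT⟩ => ⟨(h.extE_iff f).2 hf, (key ((h.extE_iff f).2 hf)).2 hT⟩⟩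

lemma isCentralExtension_hom (h : S.IsBirkhoff) {X Y : S.Ext} {f : X ⟶ Y}
    (hf : IsCentralExtension S.extE h.adjunction.unit f) :
    IsCentralExtension (extensionClass S.ext) S.cen.η f.hom := by
  obtain ⟨hf, X₀, Y₀, a, a', f₀, ha, hT, hf₀⟩ := hf
  exact ⟨(h.extE_iff f).1 hf, _, _, a.hom, a'.hom, f₀.hom, (h.extE_iff a).1 ha,
    h.isPullback_hom hT hf, (h.isTrivialExtension_iff f₀).1 hf₀⟩

lemma isNormalExtension_iff (h : S.IsBirkhoff) {X Y : S.Ext} (f : X ⟶ Y) :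
    IsNormalExtension S.extE h.adjunction.unit f ↔
      IsNormalExtension (extensionClass S.ext) S.cen.η f.hom := by
  constructor
  · rintro ⟨hf, R, π₁, π₂, hR, hπ⟩
    exact ⟨(h.extE_iff f).1 hf, _, π₁.hom, π₂.hom, h.isPullback_hom hR hf,
      (h.isTrivialExtension_iff π₁).1 hπ⟩
  · rintro ⟨hf, R, π₁, π₂, hR, hπ⟩
    let R' : S.Ext := ⟨R, hπ.1.source⟩
    exact ⟨(h.extE_iff f).2 hf, R', ObjectProperty.homMk π₁, ObjectProperty.homMk π₂,
      isPullback_of_hom hR, (h.isTrivialExtension_iff (X := R') (ObjectProperty.homMk π₁)).2 hπ⟩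

lemma isCentralExtension_iff_isNormalExtension (h : S.IsBirkhoff) {X Y : S.Ext} (f : X ⟶ Y) :
    IsCentralExtension S.extE h.adjunction.unit f ↔
      IsNormalExtension S.extE h.adjunction.unit f := by
  constructor
  · intro hf
    have hf' := h.isCentralExtension_hom hf
    exact (h.isNormalExtension_iff f).2 ((h.birkhoff.isNormalExtension_iff h.closed hf'.1).2
      (h.birkhoff.isZero_top_of_isCentralExtension h.closed hf'))
  · rintro ⟨hf, R, π₁, π₂, hR, hπ⟩
    exact ⟨hf, R, X, f, π₂, π₁, hf, hR.flip, hπ⟩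

end IsBirkhoff

end Level

/-! ### Dimension zero: a Birkhoff subcategory -/

section Base

variable {A : Type u} [Category.{v} A] {B : ObjectProperty A} {I : A ⥤ B.FullSubcategory}

lemma isIso_unit_of_mem (adj : I ⊣ B.ι) {X : A} (hX : B X) : IsIso (adj.unit.app X) :=
  inferInstanceAs (IsIso (adj.unit.app (B.ι.obj ⟨X, hX⟩)))

lemma mem_of_isIso_unit (hB : IsBirkhoff B) (adj : I ⊣ B.ι) {X : A}
    (h : IsIso (adj.unit.app X)) : B X :=
  @IsBirkhoff.of_mono _ _ _ hB _ _ (adj.unit.app X) (@IsIso.mono_of_iso _ _ _ _ _ h)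
    (I.obj X).property

lemma exists_unit_desc (adj : I ⊣ B.ι) {X Y : A} (hY : B Y) (f : X ⟶ Y) :
    ∃ t : (I.obj X).obj ⟶ Y, adj.unit.app X ≫ t = f :=
  ⟨((adj.homEquiv X ⟨Y, hY⟩).symm f).hom, (adj.homEquiv_unit _ _ _).symm.trans
    (Equiv.apply_symm_apply (adj.homEquiv X ⟨Y, hY⟩) f)⟩

lemma unit_hom_ext (adj : I ⊣ B.ι) {X Y : A} (hY : B Y) {s t : (I.obj X).obj ⟶ Y}
    (h : adj.unit.app X ≫ s = adj.unit.app X ≫ t) : s = t := by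
  have e (r : (I.obj X).obj ⟶ Y) := adj.homEquiv_unit X ⟨Y, hY⟩ (ObjectProperty.homMk r)
  exact congrArg InducedCategory.Hom.hom
    ((adj.homEquiv X ⟨Y, hY⟩).injective ((e s).trans (h.trans (e t).symm)))

lemma isExtensionClosed_top [HasZeroMorphisms A] : IsExtensionClosed (⊤ : ObjectProperty A) where
  of_isZero _ := trivial
  of_extension _ _ _ _ := trivial
  of_quotient _ _ _ _ := trivial
  of_split _ _ _ _ := trivial

variable [HasZeroMorphisms A] [SemiAbelian A]

/-- The unit is a regular epimorphism, since its image belongs to the subcategory. -/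
lemma isRegularEpi_unit (hB : IsBirkhoff B) (adj : I ⊣ B.ι) (X : A) :
    IsRegularEpi (adj.unit.app X) := by
  obtain ⟨M, e, m, he, hm, hem⟩ := exists_image (adj.unit.app X : X ⟶ (I.obj X).obj)
  have hM : B M := hB.of_mono m (I.obj X).property
  obtain ⟨s, hs⟩ := exists_unit_desc adj hM e
  have hsm : s ≫ m = 𝟙 _ := unit_hom_ext adj (I.obj X).property (by
    rw [← Category.assoc, hs]
    exact hem.trans (Category.comp_id _).symm)
  have : IsIso m := isIso_of_isRegularEpi_of_mono (isRegularEpi_of_section m s hsm) hm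
  rw [← hem]
  exact isRegularEpi_comp he inferInstance

/-- The kernel of the unit preserves regular epimorphisms: the image of `J X` in `Y` is normal, and
the quotient of `Y` by it is a quotient of `I X`, so belongs to the subcategory. -/
lemma isRegularEpi_kernel_unit_map (hB : IsBirkhoff B) (adj : I ⊣ B.ι) {X Y : A} {f : X ⟶ Y}
    (hf : IsRegularEpi f) : IsRegularEpi ((Centralization.ofUnit adj.unit).J.map f) := by
  let D := Centralization.ofUnit adj.unit
  have hX : IsKernelOf (D.μ.app X) (D.η.app X) := isKernelOf_kernel_ι _
  have hY : IsKernelOf (D.μ.app Y) (D.η.app Y) := isKernelOf_kernel_ι _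
  have hYm := hY.mono
  have ht := isRegularEpi_to_kernel_cokernel hX hf
  set π := cokernel.π (D.μ.app X ≫ f)
  obtain ⟨l, hl⟩ := exists_desc_of_isKernelOf (isRegularEpi_unit hB adj X) hX (f ≫ π) (by
    rw [← Category.assoc]
    exact cokernel.condition _)
  have hl' : IsRegularEpi l := isRegularEpi_of_comp (f := adj.unit.app X) (by
    rw [hl]
    exact isRegularEpi_comp hf (isRegularEpi_cokernel_π _))
  obtain ⟨w, hw⟩ := exists_unit_desc adj (hB.of_regularEpi l (I.obj X).property) π
  have hμπ : D.μ.app Y ≫ π = 0 := by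
    rw [← hw, ← Category.assoc]
    exact (congrArg (· ≫ w) hY.w).trans zero_comp
  have hv : kernel.lift π (D.μ.app Y) hμπ ≫ kernel.ι π = D.μ.app Y := kernel.lift_ι _ _ _
  have hvm : Mono (kernel.lift π (D.μ.app Y) hμπ) := by
    have : Mono (kernel.lift π (D.μ.app Y) hμπ ≫ kernel.ι π) := by rwa [hv]
    exact mono_of_mono _ (kernel.ι π)
  have hJ : D.J.map f ≫ kernel.lift π (D.μ.app Y) hμπ =
      kernel.lift π (D.μ.app X ≫ f) (cokernel.condition _) := by
    rw [← cancel_mono (kernel.ι π), Category.assoc, hv, kernel.lift_ι]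
    exact D.μ.naturality f
  have := isIso_of_isRegularEpi_of_mono
    (isRegularEpi_of_comp (f := D.J.map f) (by rw [hJ]; exact ht)) hvm
  rw [← IsIso.eq_comp_inv] at hJ
  change IsRegularEpi (D.J.map f)
  rw [hJ]
  exact isRegularEpi_comp ht inferInstance

lemma isBirkhoffCentralization_ofUnit (hB : IsBirkhoff B) (adj : I ⊣ B.ι) :
    IsBirkhoffCentralization (⊤ : ObjectProperty A) (Centralization.ofUnit adj.unit) where
  isKernelOf_μ _ := isKernelOf_kernel_ι _
  isRegularEpi_η _ := isRegularEpi_unit hB adj _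
  J_obj_mem _ := trivial
  J_map_mem hf := ⟨isRegularEpi_kernel_unit_map hB adj hf.1, trivial, trivial⟩
  isIso_η {X} _ := isIso_unit_of_mem adj (I.obj X).property

lemma levelZero_isBirkhoff (hB : IsBirkhoff B) (adj : I ⊣ B.ι) :
    have : SemiAbelian (levelZero adj).C := inferInstanceAs (SemiAbelian A)
    (levelZero adj).IsBirkhoff := by
  let : SemiAbelian (levelZero adj).C := inferInstanceAs (SemiAbelian A)
  refine ⟨?_, isExtensionClosed_top, isBirkhoffCentralization_ofUnit hB adj, ?_⟩
  · ext X Y f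
    exact ⟨fun hf => ⟨hf, trivial, trivial⟩, fun hf => hf.1⟩
  · intro X _
    exact ⟨fun hX => isIso_unit_of_mem adj hX, fun h => mem_of_isIso_unit hB adj h⟩

/-- Every level of the tower satisfies the invariant. -/
lemma levelSucc_isBirkhoff (hB : IsBirkhoff B) (adj : I ⊣ B.ι) (n : ℕ) :
    ∃ _ : SemiAbelian (levelSucc adj n).C, (levelSucc adj n).IsBirkhoff := by
  induction n with
  | zero =>
    let : SemiAbelian (levelZero adj).C := inferInstanceAs (SemiAbelian A)
    have h := levelZero_isBirkhoff hB adj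
    refine ⟨_, h.next fun f hf => ?_⟩
    rw [h.E_eq]
    exact h.birkhoff.isCentralExtension_iff h.closed ((h.E_iff _).1 hf)
  | succ n ih =>
    obtain ⟨_, h⟩ := ih
    refine ⟨_, h.next fun f hf => ?_⟩
    rw [h.E_eq]
    exact h.birkhoff.isNormalExtension_iff h.closed ((h.E_iff _).1 hf)

end Base

end HigherCentral

end

theorem theorem4p5 {A : Type u} [Category.{v} A] [HasZeroMorphisms A] [SemiAbelian A]
    (B : ObjectProperty A) (hB : IsBirkhoff B)
    (I : A ⥤ B.FullSubcategory) (adj : I ⊣ B.ι) (n : ℕ) :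
    ∃ (h₁ : ∀ X : (levelSucc adj n).Ext,
          (levelSucc adj n).ext ((levelSucc adj n).cen.I.obj X.obj))
      (h₂ : ∀ X : (levelSucc adj n).Ext,
          (levelSucc adj n).cext ((levelSucc adj n).cen.I.obj X.obj))
      (adj' : (levelSucc adj n).reflector h₁ h₂ ⊣
          (levelSucc adj n).central.ι),
      (∀ X : (levelSucc adj n).Ext,
          (adj'.unit.app X).hom = (levelSucc adj n).cen.η.app X.obj) ∧
      IsGaloisStructure (levelSucc adj n).extE
          (levelSucc adj n).cextZ adj' ∧
      IsAdmissible (levelSucc adj n).cextZ adj' ∧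
      IsStronglyBirkhoff (levelSucc adj n).extE adj' ∧
      ∀ {X Y : (levelSucc adj n).Ext} (f : X ⟶ Y),
        (IsCentralExtension (levelSucc adj n).extE adj'.unit f ↔
          IsNormalExtension (levelSucc adj n).extE adj'.unit f) ∧
        (IsCentralExtension (levelSucc adj n).extE adj'.unit f ↔
          (levelSucc adj (n + 1)).cext (Arrow.mk f.hom)) := by
  obtain ⟨_, h⟩ := levelSucc_isBirkhoff hB adj n
  refine ⟨h.ext_I_obj, h.cext_I_obj, h.adjunction, h.adjunction_unit, h.isGaloisStructure,
    h.isAdmissible, h.isStronglyBirkhoff, fun {X Y} f =>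
      ⟨h.isCentralExtension_iff_isNormalExtension f, ?_⟩⟩
  refine (h.isCentralExtension_iff_isNormalExtension f).trans ((h.isNormalExtension_iff f).trans ?_)
  rw [← h.E_eq]
  exact Iff.rfl
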